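/- **System.** Let $\xi_r(\tau)=e^{A_r(N)\tau}\xi_0$, $\tau\in\mathbb R$, be the state of the linear exosystem $\frac{d\xi_r}{d\tau}=A_r(N)\xi_r$ with $\xi_r(0)=\xi_0\in D_r\subset\mathbb R^{n_r}$. The state $x=(\xi_o,\xi_c,\xi_{zo},\xi_{zc})$ of the AFM system obeys, in the time $t$, $\dot\xi_o=A_o\xi_o+B_oC_c(\epsilon,N)\xi_c$, $\dot\xi_c=A_c(\epsilon,N)\xi_c+B_c(\epsilon,N)e$, $\dot\xi_{zo}=A_{zo}\xi_{zo}+B_{zo}C_{zc}\xi_{zc}$, $\dot\xi_{zc}=A_{zc}\xi_{zc}+B_{zc}e_z$, with $e=h(x,\xi_r)=C_o\xi_o-C_r\xi_r\in\mathbb R^2$ and $e_z=h_z(x)=C_{zo}\xi_{zo}+f_s(C_o\xi_o)\in\mathbb R$. In the time scale $\tau$ given by $\dot\tau=\epsilon$, $\tau(0)=0$, this reads $\frac{dx}{d\tau}=f(x,\xi_r,\epsilon,N)$, where $f$ is $\epsilon^{-1}$ times the right-hand side above. Let $T_l>0$, $\tau_\phi\in[0,T_l]$, $p\in[1,\infty]$.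 For a signal $y$ let $L_e(y[\tau])=\big(\frac1{T_l}\int_{\tau-T_l}^{\tau}|y|^p\big)^{1/p}$, or $\max_{[\tau-T_l,\tau]}|y|$ if $p=\infty$. Let $g_e,g_s:\mathbb R\to\mathbb R$. Put $\bar J(\epsilon,N,\tau)=g_e\big(L_e(h_z(M(\xi_r(\cdot),\epsilon,N))[\tau])\big)+g_s(\epsilon)$ with $M$ as below; $\bar J$ and its maximiser $\epsilon^*(N,\tau)$ also depend on $\xi_0$. **Assumptions.** There are $\bar\epsilon,\underline N>0$ such that the following holds for all real $N\ge\underline N$ and all $\xi_0\in D_r$, with all constants and comparison functions independent of $\epsilon,N,\tau,\xi_0$ unless said otherwise. 1. The exosystem is neutrally stable (each of its trajectories is bounded on $\mathbb R$) and $|\xi_r(\tau)|\le R$ for all $\tau\in\mathbb R$. 2. $f_s,g_e,g_s$ are $C^2$, and $A_c,B_c,C_c$ are $C^1$ in $\epsilon\in(0,\bar\epsilon]$. 3. There is a map $M(\xi,\epsilon,N)$, defined for all $\xi\in\mathbb R^{n_r}$, $\epsilon\in\mathbb R$, $C^2$ in $(\xi,\epsilon)$, with $M$ and $\partial M/\partial\epsilon$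 bounded on bounded sets of $(\xi,\epsilon)$ uniformly in $N$, such that for each $0<\epsilon\le\bar\epsilon$: $\bar x(\tau)=M(\xi_r(\tau),\epsilon,N)$ solves $\frac{dx}{d\tau}=f(x,\xi_r(\tau),\epsilon,N)$ on $\mathbb R$ and is uniformly globally asymptotically stable; $h(\bar x(\tau),\xi_r(\tau))=0$; and $|h_z(\bar x(\tau+T_l))-h_z(\bar x(\tau))|\le k_e/N$. Moreover there are $\alpha_{x1},\alpha_{x2}\in\mathcal K_\infty$, $\alpha_f\in\mathcal K$ and a function $V_x(\tilde x,\epsilon,N)$, $C^1$ in $(\tilde x,\epsilon)$ for $0<\epsilon\le\bar\epsilon$, whose gradient in $(\tilde x,\epsilon)$ is bounded, uniformly in $N$, on bounded sets of $\tilde x$ and $\epsilon\in[c,\bar\epsilon)$ for each $c>0$, with $\alpha_{x1}(|\tilde x|)\le V_x\le\alpha_{x2}(|\tilde x|)$ and $\frac{\partial V_x}{\partial\tilde x}\tilde f(\tilde x,\xi_r(\tau),\epsilon,N)\le-\alpha_f(|\tilde x|)$ for all $\tau\ge0$, where $\tilde f(\tilde x,\xi,\epsilon,N)=f(\tilde x+M,\xi,\epsilon,N)-f(M,\xi,\epsilon,N)$,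 $M=M(\xi,\epsilon,N)$. 4. $\bar J$ is bounded for $0<\epsilon\le\bar\epsilon$; it is twice differentiable in $\epsilon$ with bounded $\frac{\partial\bar J}{\partial\epsilon},\frac{\partial^2\bar J}{\partial\epsilon^2}$ for $0<\epsilon<\bar\epsilon$; $\epsilon^*(N,\tau)\in(0,\bar\epsilon]$ maximises $\bar J(\cdot,N,\tau)$ on $(0,\bar\epsilon]$; there is $\alpha_J\in\mathcal K$ with $\frac{\partial\bar J}{\partial\epsilon}(\epsilon,N,\tau)(\epsilon-\epsilon^*(N,\tau))\le-\alpha_J(|\epsilon-\epsilon^*(N,\tau)|)$ for $0<\epsilon<\bar\epsilon$; and there are $\underline{\epsilon^*},\overline{\epsilon^*}\in(0,\bar\epsilon)$ with $\underline{\epsilon^*}\le\epsilon^*(N,\tau)\le\overline{\epsilon^*}$ for $N>\underline N$. (All for all $\tau\in\mathbb R$.) 5. $\bar J$ (for each $0<\epsilon\le\bar\epsilon$) and $\epsilon^*$ are $C^1$ in $\tau$ with $|\partial\bar J/\partial\tau|\le k_J/N$ and $|\partial\epsilon^*/\partial\tau|\le k_\epsilon/N$. **Closed loop.** For $a,\omega,\delta>0$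 let $\tau_d=T_l+\frac{2\pi}\omega$. With $\epsilon(\tau)=\tilde\epsilon(\tau)+\epsilon^*(N,\tau)+a\sin(\omega\tau)$ (that is, $\hat\epsilon=\tilde\epsilon+\epsilon^*$), $J(\sigma)=g_e\big(L_e(h_z(\tilde x+M(\xi_r,\epsilon,N))[\sigma])\big)+g_s(\epsilon(\sigma-\tau_\phi))$ and $E(\tau)=\frac{a\omega^2\delta}\pi\int_{\tau-2\pi/\omega}^{\tau}J(\sigma)\sin(\omega(\sigma-\tau_\phi))\,d\sigma$, the closed loop is, for $\tau\ge0$, $$\frac{d\tilde x}{d\tau}=\tilde f(\tilde x,\xi_r,\epsilon,N)-\frac{\partial M}{\partial\epsilon}(\xi_r,\epsilon,N)\big(E(\tau)+a\omega\cos(\omega\tau)\big),\qquad\frac{d\tilde\epsilon}{d\tau}=E(\tau)-\frac{\partial\epsilon^*}{\partial\tau}(N,\tau),$$ with a continuous initial history of $(\tilde x,\tilde\epsilon)$ on $[-\tau_d,0]$. **Claim.** For all $\rho_x^0,\rho_\epsilon^0>0$, $\nu_\epsilon^+\in(0,\bar\epsilon/2)$ and $\nu_x,\nu_\epsilon>0$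 there exist $\rho_x,\rho_\epsilon>0$ and $a^*>0$ such that for each $a\in(0,a^*)$ there is $\omega^*>0$ such that for each $\omega\in(0,\omega^*)$ there is $\delta^*>0$ such that for each $\delta\in(0,\delta^*)$ there is $N^*>0$ such that for each $N>N^*$, each $\xi_0\in D_r$ and each initial history with $|\tilde x(\sigma)|\le\rho_x^0$, $|\tilde\epsilon(\sigma)|\le\rho_\epsilon^0$ for $\sigma\in[-\tau_d,0]$ and $\nu_\epsilon^+\le\hat\epsilon(0)\le\bar\epsilon-\nu_\epsilon^+$, the closed loop has a solution on $[-\tau_d,\infty)$, and every such solution has the following properties. * In the time scale $\tau$: $|\tilde x(\tau)|\le\rho_x$, $|\tilde\epsilon(\tau)|\le\rho_\epsilon$ and $0<\epsilon(\tau)<\bar\epsilon$ for all $\tau\ge0$; $\limsup_{\tau\to\infty}|\tilde x(\tau)|\le\nu_x$ and $\limsup_{\tau\to\infty}|\tilde\epsilon(\tau)|\le\nu_\epsilon$. * In the original time $t$: the equation $\dot\tau=\epsilon(\tau)$, $\tau(0)=0$ has a solution $\tau(t)$ on $t\ge0$; each such solution is strictly increasing and unbounded; and, writing $\tilde x(t)=\tilde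 x(\tau(t))$, $\tilde\epsilon(t)=\tilde\epsilon(\tau(t))$, the same bounds hold: $|\tilde x(t)|\le\rho_x$, $|\tilde\epsilon(t)|\le\rho_\epsilon$ for all $t\ge0$, $\limsup_{t\to\infty}|\tilde x(t)|\le\nu_x$ and $\limsup_{t\to\infty}|\tilde\epsilon(t)|\le\nu_\epsilon$. -/

import Mathlib

open Set Filter Topology
open scoped ENNReal Matrix

namespace AFM

/-! ### Comparison functions -/

/-- Class `K`: continuous, strictly increasing on `[0, ∞)`, zero at zero. -/
structure ClassK (α : ℝ → ℝ) : Prop where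
  continuousOn : ContinuousOn α (Ici 0)
  strictMonoOn : StrictMonoOn α (Ici 0)
  map_zero : α 0 = 0

/-- Class `K∞`: an unbounded class `K` function. -/
structure ClassKInf (α : ℝ → ℝ) : Prop extends ClassK α where
  tendsto_atTop : Tendsto α atTop atTop

/-- Class `KL`. -/
structure ClassKL (β : ℝ → ℝ → ℝ) : Prop where
  classK : ∀ s, 0 ≤ s → ClassK (fun r => β r s)
  antitoneOn : ∀ r, 0 ≤ r → AntitoneOn (β r) (Ici 0)
  tendsto_zero : ∀ r, 0 ≤ r → Tendsto (β r) atTop (𝓝 0)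

/-- The trajectory `xbar` of `dx/dτ = F(τ, x)` is uniformly globally asymptotically stable. -/
def IsUGAS {X : Type*} [NormedAddCommGroup X] [NormedSpace ℝ X]
    (F : ℝ → X → X) (xbar : ℝ → X) : Prop :=
  ∃ β : ℝ → ℝ → ℝ, ClassKL β ∧
    ∀ τ₀ : ℝ, 0 ≤ τ₀ → ∀ y : ℝ → X,
      (∀ τ, τ₀ ≤ τ → HasDerivWithinAt y (F τ (y τ)) (Ici τ₀) τ) →
      ∀ τ, τ₀ ≤ τ → ‖y τ - xbar τ‖ ≤ β ‖y τ₀ - xbar τ₀‖ (τ - τ₀)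

/-! ### The linear exosystem -/

/-- The solution of `dξ/dτ = A ξ`, `ξ(0) = ξ₀`, on the whole real line. -/
noncomputable def exoFlow {n : ℕ} (A : Matrix (Fin n) (Fin n) ℝ)
    (ξ₀ : EuclideanSpace ℝ (Fin n)) (τ : ℝ) : EuclideanSpace ℝ (Fin n) :=
  let L : EuclideanSpace ℝ (Fin n) →L[ℝ] EuclideanSpace ℝ (Fin n) :=
    Matrix.toEuclideanCLM (n := Fin n) (𝕜 := ℝ) A
  NormedSpace.exp (τ • L) ξ₀

/-- A linear exosystem is neutrally stable (all eigenvalues imaginary and semisimple) iff each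
of its trajectories is bounded in both time directions. -/
def NeutrallyStable {n : ℕ} (A : Matrix (Fin n) (Fin n) ℝ) : Prop :=
  ∀ ξ₀, Bornology.IsBounded (range (exoFlow A ξ₀))

/-! ### The line functional -/

/-- The `L_p` average (`p < ∞`) or the maximum (`p = ∞`) of `|y|` over `[τ - T, τ]`. -/
noncomputable def lineNorm (p : ℝ≥0∞) (T : ℝ) (y : ℝ → ℝ) (τ : ℝ) : ℝ :=
  if p = ∞ then sSup ((fun σ => |y σ|) '' Icc (τ - T) τ)
  else (1 / T * ∫ σ in (τ - T)..τ, |y σ| ^ p.toReal) ^ (1 / p.toReal)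

/-! ### The AFM system -/

/-- The state `x = (ξ_o, ξ_c, ξ_zo, ξ_zc)` with the Euclidean norm. -/
abbrev State (no nc nzo nzc : ℕ) : Type :=
  EuclideanSpace ℝ (Fin no ⊕ Fin nc ⊕ Fin nzo ⊕ Fin nzc)

/-- The data of the AFM system and of the performance function. -/
structure System (nr no nc nzo nzc : ℕ) where
  /-- exosystem matrix, as a function of the number of scan lines `N` -/
  Ar : ℝ → Matrix (Fin nr) (Fin nr) ℝ
  Cr : Matrix (Fin 2) (Fin nr) ℝ
  /-- the initial states of the exosystem -/
  Dr : Set (EuclideanSpace ℝ (Fin nr))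
  /-- XY actuator -/
  Ao : Matrix (Fin no) (Fin no) ℝ
  Bo : Matrix (Fin no) (Fin 2) ℝ
  Co : Matrix (Fin 2) (Fin no) ℝ
  /-- XY controller, as a function of the scan rate multiplier `ε` and of `N` -/
  Ac : ℝ → ℝ → Matrix (Fin nc) (Fin nc) ℝ
  Bc : ℝ → ℝ → Matrix (Fin nc) (Fin 2) ℝ
  Cc : ℝ → ℝ → Matrix (Fin 2) (Fin nc) ℝ
  /-- Z actuator (scalar input and output) -/
  Azo : Matrix (Fin nzo) (Fin nzo) ℝ
  Bzo : Fin nzo → ℝ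
  Czo : Fin nzo → ℝ
  /-- Z controller (scalar input and output) -/
  Azc : Matrix (Fin nzc) (Fin nzc) ℝ
  Bzc : Fin nzc → ℝ
  Czc : Fin nzc → ℝ
  /-- sample topography -/
  fs : EuclideanSpace ℝ (Fin 2) → ℝ
  /-- nominal line period -/
  Tl : ℝ
  Tl_pos : 0 < Tl
  /-- exponent of the line functional -/
  p : ℝ≥0∞
  one_le_p : 1 ≤ p
  /-- delay of the scan rate channel -/
  τφ : ℝ
  τφ_mem : τφ ∈ Icc 0 Tl
  ge : ℝ → ℝ
  gs : ℝ → ℝ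

namespace System

variable {nr no nc nzo nzc : ℕ} (S : System nr no nc nzo nzc)

/-- XY tracking error `e = p - r = C_o ξ_o - C_r ξ_r`. -/
noncomputable def h (x : State no nc nzo nzc) (ξ : EuclideanSpace ℝ (Fin nr)) :
    EuclideanSpace ℝ (Fin 2) :=
  WithLp.toLp 2 (S.Co *ᵥ (fun i => x (.inl i)) - S.Cr *ᵥ ξ.ofLp)

/-- Z regulation error `e_z = C_zo ξ_zo + f_s(C_o ξ_o)`. -/
noncomputable def hz (x : State no nc nzo nzc) : ℝ :=
  S.Czo ⬝ᵥ (fun i => x (.inr (.inr (.inl i)))) +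
    S.fs (WithLp.toLp 2 (S.Co *ᵥ (fun i => x (.inl i))))

/-- Right-hand side of the AFM dynamics in the original time `t`. -/
noncomputable def field (x : State no nc nzo nzc) (ξ : EuclideanSpace ℝ (Fin nr)) (ε N : ℝ) :
    State no nc nzo nzc :=
  let xo : Fin no → ℝ := fun i => x (.inl i)
  let xc : Fin nc → ℝ := fun i => x (.inr (.inl i))
  let xzo : Fin nzo → ℝ := fun i => x (.inr (.inr (.inl i)))
  let xzc : Fin nzc → ℝ := fun i => x (.inr (.inr (.inr i)))
  WithLp.toLp 2 (Sum.elim (S.Ao *ᵥ xo + S.Bo *ᵥ (S.Cc ε N *ᵥ xc))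
    (Sum.elim (S.Ac ε N *ᵥ xc + S.Bc ε N *ᵥ (S.h x ξ).ofLp)
      (Sum.elim (S.Azo *ᵥ xzo + (S.Czc ⬝ᵥ xzc) • S.Bzo)
        (S.Azc *ᵥ xzc + S.hz x • S.Bzc))))

/-- Right-hand side of the AFM dynamics in the time scale `τ`, where `dτ/dt = ε`. -/
noncomputable def f (x : State no nc nzo nzc) (ξ : EuclideanSpace ℝ (Fin nr)) (ε N : ℝ) :
    State no nc nzo nzc :=
  ε⁻¹ • S.field x ξ ε N

/-- The exosystem trajectory `ξ_r(τ)` with `ξ_r(0) = ξ₀`. -/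
noncomputable def ξr (N : ℝ) (ξ₀ : EuclideanSpace ℝ (Fin nr)) (τ : ℝ) :
    EuclideanSpace ℝ (Fin nr) :=
  exoFlow (S.Ar N) ξ₀ τ

section SteadyState

variable (M : EuclideanSpace ℝ (Fin nr) → ℝ → ℝ → State no nc nzo nzc)

/-- Error dynamics `f(x̃ + M, ξ, ε, N) - f(M, ξ, ε, N)`. -/
noncomputable def ftilde (x : State no nc nzo nzc) (ξ : EuclideanSpace ℝ (Fin nr)) (ε N : ℝ) :
    State no nc nzo nzc :=
  S.f (x + M ξ ε N) ξ ε N - S.f (M ξ ε N) ξ ε N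

/-- The steady-state performance map `J̄(ε, N, τ)` along the reference that starts at `ξ₀`. -/
noncomputable def Jbar (ξ₀ : EuclideanSpace ℝ (Fin nr)) (ε N τ : ℝ) : ℝ :=
  S.ge (lineNorm S.p S.Tl (fun σ => S.hz (M (S.ξr N ξ₀ σ) ε N)) τ) + S.gs ε

/-! ### Standing assumptions -/

/-- The references come from a neutrally stable exosystem whose state stays in a bounded set. -/
structure ReferenceAssumption (Nmin : ℝ) : Prop where
  neutrallyStable : ∀ N, Nmin ≤ N → NeutrallyStable (S.Ar N)
  bounded : ∃ R : ℝ, ∀ N, Nmin ≤ N → ∀ ξ₀ ∈ S.Dr, ∀ τ : ℝ, ‖S.ξr N ξ₀ τ‖ ≤ R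

/-- Regularity of the topography, of the performance function and of the scheduled controller. -/
structure RegularityAssumption (εbar Nmin : ℝ) : Prop where
  fs_smooth : ContDiff ℝ 2 S.fs
  ge_smooth : ContDiff ℝ 2 S.ge
  gs_smooth : ContDiff ℝ 2 S.gs
  Ac_smooth : ∀ N, Nmin ≤ N → ∀ i j, ContDiffOn ℝ 1 (fun ε => S.Ac ε N i j) (Ioc 0 εbar)
  Bc_smooth : ∀ N, Nmin ≤ N → ∀ i j, ContDiffOn ℝ 1 (fun ε => S.Bc ε N i j) (Ioc 0 εbar)
  Cc_smooth : ∀ N, Nmin ≤ N → ∀ i j, ContDiffOn ℝ 1 (fun ε => S.Cc ε N i j) (Ioc 0 εbar)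

/-- The steady-state solution `M(ξ_r(τ), ε, N)`: existence, stability, and Lyapunov function.
The bounds on `M`, `V` and their first derivatives on bounded sets are uniform in `N`. -/
structure SteadyStateAssumption (εbar Nmin : ℝ) : Prop where
  smooth : ∀ N, Nmin ≤ N →
    ContDiff ℝ 2 (fun z : EuclideanSpace ℝ (Fin nr) × ℝ => M z.1 z.2 N)
  locally_bounded : ∀ R : ℝ, ∃ C : ℝ, ∀ N, Nmin ≤ N → ∀ ξ, ‖ξ‖ ≤ R → ∀ ε, |ε| ≤ R →
    ‖M ξ ε N‖ ≤ C ∧ ‖deriv (fun η => M ξ η N) ε‖ ≤ C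
  steady : ∀ ε ∈ Ioc 0 εbar, ∀ N, Nmin ≤ N → ∀ ξ₀ ∈ S.Dr, ∀ τ : ℝ,
    HasDerivAt (fun σ => M (S.ξr N ξ₀ σ) ε N)
      (S.f (M (S.ξr N ξ₀ τ) ε N) (S.ξr N ξ₀ τ) ε N) τ
  ugas : ∀ ε ∈ Ioc 0 εbar, ∀ N, Nmin ≤ N → ∀ ξ₀ ∈ S.Dr,
    IsUGAS (fun τ x => S.f x (S.ξr N ξ₀ τ) ε N) (fun τ => M (S.ξr N ξ₀ τ) ε N)
  tracking : ∀ ε ∈ Ioc 0 εbar, ∀ N, Nmin ≤ N → ∀ ξ₀ ∈ S.Dr, ∀ τ : ℝ,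
    S.h (M (S.ξr N ξ₀ τ) ε N) (S.ξr N ξ₀ τ) = 0
  almost_periodic : ∃ ke : ℝ, 0 < ke ∧
    ∀ ε ∈ Ioc 0 εbar, ∀ N, Nmin ≤ N → ∀ ξ₀ ∈ S.Dr, ∀ τ : ℝ,
      |S.hz (M (S.ξr N ξ₀ (τ + S.Tl)) ε N) - S.hz (M (S.ξr N ξ₀ τ) ε N)| ≤ ke / N
  lyapunov : ∃ (α₁ α₂ αf : ℝ → ℝ) (V : State no nc nzo nzc → ℝ → ℝ → ℝ),
    ClassKInf α₁ ∧ ClassKInf α₂ ∧ ClassK αf ∧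
    (∀ N, Nmin ≤ N →
      ContDiffOn ℝ 1 (fun z : State no nc nzo nzc × ℝ => V z.1 z.2 N) (univ ×ˢ Ioc 0 εbar)) ∧
    (∀ R c : ℝ, 0 < c → ∃ C : ℝ, ∀ N, Nmin ≤ N → ∀ x, ‖x‖ ≤ R → ∀ ε ∈ Ico c εbar,
      ‖fderiv ℝ (fun z : State no nc nzo nzc × ℝ => V z.1 z.2 N) (x, ε)‖ ≤ C) ∧
    ∀ ε ∈ Ioc 0 εbar, ∀ N, Nmin ≤ N → ∀ ξ₀ ∈ S.Dr, ∀ x,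
      α₁ ‖x‖ ≤ V x ε N ∧ V x ε N ≤ α₂ ‖x‖ ∧
      ∀ τ : ℝ, 0 ≤ τ →
        fderiv ℝ (fun y => V y ε N) x (S.ftilde M x (S.ξr N ξ₀ τ) ε N) ≤ -αf ‖x‖

/-- The steady-state performance map has a well-behaved maximum at `εstar ξ₀ N τ`. -/
structure MaximumAssumption (εstar : EuclideanSpace ℝ (Fin nr) → ℝ → ℝ → ℝ)
    (εbar Nmin : ℝ) : Prop where
  bounded : ∃ B : ℝ, ∀ ε ∈ Ioc 0 εbar, ∀ N, Nmin ≤ N → ∀ ξ₀ ∈ S.Dr, ∀ τ : ℝ,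
    |S.Jbar M ξ₀ ε N τ| ≤ B
  deriv_bounded : ∃ B : ℝ, ∀ ε ∈ Ioo 0 εbar, ∀ N, Nmin ≤ N → ∀ ξ₀ ∈ S.Dr, ∀ τ : ℝ,
    DifferentiableAt ℝ (fun η => S.Jbar M ξ₀ η N τ) ε ∧
    DifferentiableAt ℝ (deriv fun η => S.Jbar M ξ₀ η N τ) ε ∧
    |deriv (fun η => S.Jbar M ξ₀ η N τ) ε| ≤ B ∧
    |deriv (deriv fun η => S.Jbar M ξ₀ η N τ) ε| ≤ B
  maximum : ∀ N, Nmin ≤ N → ∀ ξ₀ ∈ S.Dr, ∀ τ : ℝ,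
    εstar ξ₀ N τ ∈ Ioc 0 εbar ∧
    IsMaxOn (fun ε => S.Jbar M ξ₀ ε N τ) (Ioc 0 εbar) (εstar ξ₀ N τ)
  gradient : ∃ αJ : ℝ → ℝ, ClassK αJ ∧
    ∀ ε ∈ Ioo 0 εbar, ∀ N, Nmin ≤ N → ∀ ξ₀ ∈ S.Dr, ∀ τ : ℝ,
      deriv (fun η => S.Jbar M ξ₀ η N τ) ε * (ε - εstar ξ₀ N τ) ≤ -αJ |ε - εstar ξ₀ N τ|
  interior : ∃ lo hi : ℝ, lo ∈ Ioo 0 εbar ∧ hi ∈ Ioo 0 εbar ∧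
    ∀ N, Nmin < N → ∀ ξ₀ ∈ S.Dr, ∀ τ : ℝ, εstar ξ₀ N τ ∈ Icc lo hi

/-- The steady-state performance map and its maximiser vary slowly in `τ`. -/
structure SlowlyVaryingAssumption (εstar : EuclideanSpace ℝ (Fin nr) → ℝ → ℝ → ℝ)
    (εbar Nmin : ℝ) : Prop where
  Jbar_smooth : ∀ ε ∈ Ioc 0 εbar, ∀ N, Nmin ≤ N → ∀ ξ₀ ∈ S.Dr,
    ContDiff ℝ 1 (fun τ => S.Jbar M ξ₀ ε N τ)
  εstar_smooth : ∀ N, Nmin ≤ N → ∀ ξ₀ ∈ S.Dr, ContDiff ℝ 1 (fun τ => εstar ξ₀ N τ)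
  Jbar_slow : ∃ kJ : ℝ, 0 < kJ ∧ ∀ ε ∈ Ioc 0 εbar, ∀ N, Nmin ≤ N → ∀ ξ₀ ∈ S.Dr, ∀ τ : ℝ,
    |deriv (fun σ => S.Jbar M ξ₀ ε N σ) τ| ≤ kJ / N
  εstar_slow : ∃ kε : ℝ, 0 < kε ∧ ∀ N, Nmin ≤ N → ∀ ξ₀ ∈ S.Dr, ∀ τ : ℝ,
    |deriv (fun σ => εstar ξ₀ N σ) τ| ≤ kε / N

/-! ### The closed loop in the time scale `τ` -/

/-- Length `τ_d` of the histories. -/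
noncomputable def τd (ω : ℝ) : ℝ := S.Tl + 2 * Real.pi / ω

/-- The performance output `J(x̃[σ], ξ_r[σ], ε[σ], N)` at time `σ`. -/
noncomputable def J (N : ℝ) (ξ₀ : EuclideanSpace ℝ (Fin nr))
    (x : ℝ → State no nc nzo nzc) (eps : ℝ → ℝ) (σ : ℝ) : ℝ :=
  S.ge (lineNorm S.p S.Tl (fun s => S.hz (x s + M (S.ξr N ξ₀ s) (eps s) N)) σ) +
    S.gs (eps (σ - S.τφ))

/-- The optimiser `dε̂/dτ`. -/
noncomputable def adaptRate (a ω δ N : ℝ) (ξ₀ : EuclideanSpace ℝ (Fin nr))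
    (x : ℝ → State no nc nzo nzc) (eps : ℝ → ℝ) (τ : ℝ) : ℝ :=
  a * ω ^ 2 * δ / Real.pi *
    ∫ σ in (τ - 2 * Real.pi / ω)..τ, S.J M N ξ₀ x eps σ * Real.sin (ω * (σ - S.τφ))

end SteadyState

end System

/-- The applied scan rate `ε = ε̂ + a sin(ωτ)`, where `ε̂ = ε̃ + ε*`. -/
noncomputable def scanRate (εs : ℝ → ℝ) (a ω : ℝ) (e : ℝ → ℝ) (τ : ℝ) : ℝ :=
  e τ + εs τ + a * Real.sin (ω * τ)

/-- `(x, e) = (x̃, ε̃)` is a solution, on `[-τ_d, ∞)`, of the closed loop driven by the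
reference that starts at `ξ₀`; its restriction to `[-τ_d, 0]` is the initial history. -/
structure System.IsSolution {nr no nc nzo nzc : ℕ} (S : System nr no nc nzo nzc)
    (M : EuclideanSpace ℝ (Fin nr) → ℝ → ℝ → State no nc nzo nzc)
    (εstar : EuclideanSpace ℝ (Fin nr) → ℝ → ℝ → ℝ) (a ω δ N : ℝ)
    (ξ₀ : EuclideanSpace ℝ (Fin nr)) (x : ℝ → State no nc nzo nzc) (e : ℝ → ℝ) : Prop where
  continuousOn_x : ContinuousOn x (Ici (-S.τd ω))
  continuousOn_e : ContinuousOn e (Ici (-S.τd ω))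
  hasDeriv_x : ∀ τ : ℝ, 0 ≤ τ →
    HasDerivWithinAt x
      (S.ftilde M (x τ) (S.ξr N ξ₀ τ) (scanRate (εstar ξ₀ N) a ω e τ) N -
        (S.adaptRate M a ω δ N ξ₀ x (scanRate (εstar ξ₀ N) a ω e) τ +
          a * ω * Real.cos (ω * τ)) •
          deriv (fun η => M (S.ξr N ξ₀ τ) η N) (scanRate (εstar ξ₀ N) a ω e τ))
      (Ici 0) τ
  hasDeriv_e : ∀ τ : ℝ, 0 ≤ τ →
    HasDerivWithinAt e
      (S.adaptRate M a ω δ N ξ₀ x (scanRate (εstar ξ₀ N) a ω e) τ - deriv (εstar ξ₀ N) τ)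
      (Ici 0) τ

/-- Admissible initial histories `(x̃[0], ε̃[0])` on `[-τ_d, 0]`. -/
structure System.IsInitialHistory {nr no nc nzo nzc : ℕ} (S : System nr no nc nzo nzc)
    (εs : ℝ → ℝ) (εbar ω ρx₀ ρε₀ νpos : ℝ)
    (x : ℝ → State no nc nzo nzc) (e : ℝ → ℝ) : Prop where
  continuousOn_x : ContinuousOn x (Icc (-S.τd ω) 0)
  continuousOn_e : ContinuousOn e (Icc (-S.τd ω) 0)
  norm_x_le : ∀ σ ∈ Icc (-S.τd ω) 0, ‖x σ‖ ≤ ρx₀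
  abs_e_le : ∀ σ ∈ Icc (-S.τd ω) 0, |e σ| ≤ ρε₀
  start : e 0 + εs 0 ∈ Icc νpos (εbar - νpos)

/-- `θ(t) = τ(t)` solves `dτ/dt = ε`, `τ(0) = 0` for `t ≥ 0`, where `eps` is the scan rate as a
function of `τ`; a signal `y` given in the time scale `τ` is `y ∘ θ` in the original time. -/
structure IsClock (eps θ : ℝ → ℝ) : Prop where
  map_zero : θ 0 = 0
  hasDeriv : ∀ t : ℝ, 0 ≤ t → HasDerivWithinAt θ (eps (θ t)) (Ici 0) t

end AFM

/-!
The proof separates two time scales. The state error `x̃` is fast: its Lyapunov function decays at a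
rate that does not depend on the dither, while the drift of the equilibrium `M(ξ_r, ε)` has speed at
most `2aω`. Hence, for small `ω`, `x̃` settles below any prescribed level `r` within a time `Tx` that
is independent of `δ`, and during that time the estimate `ε̂`, whose speed is at most a constant
times `aωδ`, hardly moves if `δ` is small. Afterwards the performance output `J` is close to the
steady-state map `J̄(ε̂ + a sin ωσ)`, and correlating it with the dither over one period gives
`dε̂/dτ = a²ωδ (∂J̄/∂ε(ε̂) cos(ωτ_φ) + error)` (`abs_adaptRate_sub_gradient_le`). The error is small
compared with the slope of `J̄` away from the maximiser when `a`, then `r` and `ω`, then `δ`, then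
`1/N` are small. So `|ε̃|` decreases until it is small, and `ε̂` is pushed away from the margins
of `(0, εbar)`. The lemma `trapped` is the abstract form of this argument; a continuation principle
makes the differential inequalities available, since these hold only as long as `(x̃, ε)` has stayed
in a compact region. `eventually_trapped` chooses the parameters.

The vector field is under control only for `ε` in `(0, εbar]`, and only on bounded sets. Solutions
are therefore constructed for the equations with clamped arguments. There the right-hand side is a
bounded Lipschitz functional of the past, and Banach's fixed point theorem in an exponentially
weighted sup norm gives a global solution (`exists_solution_of_lipschitz`). By the a priori bounds
this solution never meets the clamps. Lipschitz dependence of `J` on the histories is Minkowski's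
inequality for the line functional (`abs_lineNorm_sub_le`).

In the original time `t`, the clock is the inverse of `τ ↦ ∫ ds / ε(s)`, which exists and is unbounded
because `ε` stays between two positive constants.
-/

open MeasureTheory

namespace AFM

/-! ### Comparison and continuation on the half-line -/

/-- If the right derivative of `W` is at most `-q < 0` wherever `b ≤ W`, then `W` decreases at
rate `q` until it reaches the level `b`, and never rises above `b` again. -/
lemma le_max_sub_of_deriv_le {W w : ℝ → ℝ} {t₀ T b q : ℝ} (hq : 0 < q)
    (hW : ContinuousOn W (Icc t₀ T))
    (hd : ∀ t ∈ Ico t₀ T, HasDerivWithinAt W (w t) (Ici t) t)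
    (hw : ∀ t ∈ Ico t₀ T, b ≤ W t → w t ≤ -q) {t : ℝ} (ht : t ∈ Icc t₀ T) :
    W t ≤ max b (W t₀ - q * (t - t₀)) := by
  by_cases hb : W t ≤ b
  · exact le_max_of_le_left hb
  push Not at hb
  have key : ∀ s ∈ Icc t₀ t, b < W s := by
    intro s hs
    by_contra hcon
    push Not at hcon
    have hle := image_le_of_deriv_right_lt_deriv_boundary' (f := W) (f' := w) (a := s) (b := t)
      (B := fun _ => b) (B' := fun _ => 0)
      (hW.mono (Icc_subset_Icc hs.1 ht.2))
      (fun x hx => hd x ⟨hs.1.trans hx.1, hx.2.trans_le ht.2⟩) hcon continuousOn_const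
      (fun x _ => hasDerivWithinAt_const _ _ _)
      (fun x hx hxe => by
        have := hw x ⟨hs.1.trans hx.1, hx.2.trans_le ht.2⟩ hxe.ge
        linarith) (right_mem_Icc.2 hs.2)
    linarith
  refine le_max_of_le_right ?_
  refine image_le_of_deriv_right_le_deriv_boundary (f := W) (f' := w) (a := t₀) (b := t)
      (B := fun x => W t₀ - q * (x - t₀)) (B' := fun _ => -q)
      (hW.mono (Icc_subset_Icc le_rfl ht.2)) (fun x hx => hd x ⟨hx.1, hx.2.trans_le ht.2⟩)
      (by simp) (by fun_prop) (fun x _ => ?_) (fun x hx => ?_) (right_mem_Icc.2 ht.1)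
  · have h := (((hasDerivAt_id x).sub_const t₀).const_mul q).const_sub (W t₀)
    simpa using h.hasDerivWithinAt
  · exact hw x ⟨hx.1, hx.2.trans_le ht.2⟩ (key x ⟨hx.1, hx.2.le⟩).le

/-- Continuation principle: a continuous function that starts negative, and is negative at `τ`
whenever it is nonpositive on `[0, τ]`, is negative on the half-line. -/
lemma neg_of_bootstrap {m : ℝ → ℝ} (hm : ContinuousOn m (Ici 0)) (h0 : m 0 < 0)
    (h : ∀ τ, 0 ≤ τ → (∀ s ∈ Icc 0 τ, m s ≤ 0) → m τ < 0) : ∀ τ, 0 ≤ τ → m τ < 0 := by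
  intro τ hτ
  by_contra hcon
  push Not at hcon
  have hmc : ContinuousOn m (Icc 0 τ) := hm.mono Icc_subset_Ici_self
  have hK : IsCompact (Icc 0 τ ∩ m ⁻¹' Ici 0) :=
    isCompact_Icc.of_isClosed_subset (hmc.preimage_isClosed_of_isClosed isClosed_Icc isClosed_Ici)
      inter_subset_left
  obtain ⟨s, ⟨hs, hs'⟩, hmin⟩ := hK.exists_isLeast ⟨τ, ⟨hτ, le_rfl⟩, hcon⟩
  obtain ⟨u, hu, hu0⟩ := intermediate_value_Icc hs.1
    (hmc.mono (Icc_subset_Icc le_rfl hs.2)) ⟨h0.le, hs'⟩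
  have hus : u = s := le_antisymm hu.2 (hmin ⟨⟨hu.1, hu.2.trans hs.2⟩, hu0.ge⟩)
  subst hus
  have := h u hs.1 fun v hv => by
    by_contra hv'
    push Not at hv'
    have h1 : u ≤ v := hmin ⟨⟨hv.1, hv.2.trans hs.2⟩, hv'.le⟩
    have h2 : v = u := le_antisymm hv.2 h1
    rw [h2, hu0] at hv'
    exact lt_irrefl _ hv'
  exact absurd this (by rw [hu0]; exact lt_irrefl _)

/-! ### Functional differential equations with a bounded Lipschitz right-hand side -/

/-- Global existence for a retarded functional differential equation. The right-hand side
`F y τ` may depend on the whole past of `y`; it is bounded, and Lipschitz for the sup norm of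
the past. The solution is the fixed point of the integral equation, which is a contraction for
the sup norm weighted by `exp (-(L + 1) τ)`. -/
theorem exists_solution_of_lipschitz {E : Type*} [NormedAddCommGroup E] [NormedSpace ℝ E]
    [CompleteSpace E] (F : (ℝ → E) → ℝ → E) {C L : ℝ} (hL : 0 ≤ L)
    (hcont : ∀ y, Continuous y → ContinuousOn (F y) (Ici 0))
    (hbdd : ∀ y, Continuous y → ∀ σ, 0 ≤ σ → ‖F y σ‖ ≤ C)
    (hlip : ∀ y z, Continuous y → Continuous z → ∀ σ, 0 ≤ σ → ∀ D,
      (∀ s ≤ σ, ‖y s - z s‖ ≤ D) → ‖F y σ - F z σ‖ ≤ L * D)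
    (y₀ : ℝ → E) (hy₀ : Continuous y₀) :
    ∃ y, Continuous y ∧ (∀ s ≤ 0, y s = y₀ s) ∧
      ∀ τ, 0 ≤ τ → HasDerivWithinAt y (F y τ) (Ici 0) τ := by
  set l : ℝ := L + 1 with hl
  have hl0 : 0 < l := by positivity
  have hC : 0 ≤ C := (norm_nonneg _).trans (hbdd y₀ hy₀ 0 le_rfl)
  let Y : (ℝ → E) → ℝ → E := fun z τ => y₀ (min τ 0) + Real.exp (l * max τ 0) • z τ
  have hY : ∀ z : BoundedContinuousFunction ℝ E, Continuous (Y z) := fun z => by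
    have := z.continuous
    simp only [Y]
    fun_prop
  let G : (ℝ → E) → ℝ → E := fun y σ => F y (max σ 0)
  have hG : ∀ y, Continuous y → Continuous (G y) := fun y hy =>
    (hcont y hy).comp_continuous (by fun_prop) fun x => mem_Ici.2 (le_max_right _ _)
  let I : (ℝ → E) → ℝ → E := fun y τ => ∫ σ in (0 : ℝ)..max τ 0, G y σ
  have hIderiv : ∀ y, Continuous y → ∀ τ, HasDerivAt (fun u => ∫ σ in (0 : ℝ)..u, G y σ) (G y τ) τ :=
    fun y hy τ => (hG y hy).integral_hasStrictDerivAt 0 τ |>.hasDerivAt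
  have hI : ∀ y, Continuous y → Continuous (I y) := fun y hy => by
    have h1 : Continuous fun u => ∫ σ in (0 : ℝ)..u, G y σ :=
      continuous_iff_continuousAt.2 fun τ => (hIderiv y hy τ).continuousAt
    exact h1.comp (by fun_prop : Continuous fun τ : ℝ => max τ 0)
  let T₀ : (ℝ → E) → ℝ → E := fun z τ => Real.exp (-(l * max τ 0)) • I (Y z) τ
  have hT₀c : ∀ z : BoundedContinuousFunction ℝ E, Continuous (T₀ z) := fun z => by
    have := hI _ (hY z)
    simp only [T₀]
    fun_prop
  have hT₀b : ∀ z : BoundedContinuousFunction ℝ E, ∀ τ, ‖T₀ z τ‖ ≤ C := fun z τ => by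
    have hm : 0 ≤ max τ 0 := le_max_right _ _
    have h1 : ‖I (Y z) τ‖ ≤ C * max τ 0 := by
      have := intervalIntegral.norm_integral_le_of_norm_le_const (a := 0) (b := max τ 0)
        (f := G (Y z)) (C := C) fun σ _ => hbdd _ (hY z) _ (le_max_right _ _)
      rwa [sub_zero, abs_of_nonneg hm] at this
    have h2 : max τ 0 ≤ Real.exp (l * max τ 0) := by
      have := Real.add_one_le_exp (l * max τ 0)
      nlinarith
    simp only [T₀, norm_smul, Real.norm_eq_abs, Real.abs_exp]
    calc Real.exp (-(l * max τ 0)) * ‖I (Y z) τ‖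
        ≤ Real.exp (-(l * max τ 0)) * (C * Real.exp (l * max τ 0)) := by gcongr; nlinarith
      _ = C := by rw [mul_left_comm, ← Real.exp_add]; simp
  let T : BoundedContinuousFunction ℝ E → BoundedContinuousFunction ℝ E := fun z =>
    BoundedContinuousFunction.ofNormedAddCommGroup (T₀ z) (hT₀c z) C (hT₀b z)
  have hTlip : LipschitzWith (Real.toNNReal (L / l)) T := by
    refine LipschitzWith.of_dist_le_mul fun z w => ?_
    rw [Real.coe_toNNReal _ (by positivity)]
    refine (BoundedContinuousFunction.dist_le (by positivity)).2 fun τ => ?_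
    have hm : 0 ≤ max τ 0 := le_max_right _ _
    have hd : ∀ σ, 0 ≤ σ → ∀ s ≤ σ, ‖Y z s - Y w s‖ ≤ Real.exp (l * σ) * dist z w := by
      intro σ hσ s hs
      simp only [Y, add_sub_add_left_eq_sub, ← smul_sub, norm_smul, Real.norm_eq_abs, Real.abs_exp]
      gcongr
      · exact max_le hs hσ
      · rw [← dist_eq_norm]; exact BoundedContinuousFunction.dist_coe_le_dist s
    have h1 : ‖I (Y z) τ - I (Y w) τ‖ ≤
        ∫ σ in (0 : ℝ)..max τ 0, L * (Real.exp (l * σ) * dist z w) := by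
      simp only [I]
      rw [← intervalIntegral.integral_sub ((hG _ (hY z)).intervalIntegrable _ _)
        ((hG _ (hY w)).intervalIntegrable _ _)]
      refine intervalIntegral.norm_integral_le_of_norm_le hm (ae_of_all _ fun σ hσ => ?_)
        (Continuous.intervalIntegrable (by fun_prop) _ _)
      have h := hlip _ _ (hY z) (hY w) σ hσ.1.le _ (hd σ hσ.1.le)
      simpa only [G, max_eq_left hσ.1.le] using h
    have h2 : ∫ σ in (0 : ℝ)..max τ 0, L * (Real.exp (l * σ) * dist z w) =
        L / l * dist z w * (Real.exp (l * max τ 0) - 1) := by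
      rw [intervalIntegral.integral_const_mul, intervalIntegral.integral_mul_const,
        intervalIntegral.integral_comp_mul_left _ hl0.ne', integral_exp]
      simp
      field_simp
    rw [dist_eq_norm]
    change ‖T₀ z τ - T₀ w τ‖ ≤ _
    simp only [T₀, ← smul_sub, norm_smul, Real.norm_eq_abs, Real.abs_exp]
    calc Real.exp (-(l * max τ 0)) * ‖I (Y z) τ - I (Y w) τ‖
        ≤ Real.exp (-(l * max τ 0)) * (L / l * dist z w * Real.exp (l * max τ 0)) := by
          gcongr
          refine h1.trans (h2.le.trans ?_)
          have : 0 ≤ L / l * dist z w := by positivity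
          nlinarith
      _ = L / l * dist z w := by rw [mul_left_comm, ← Real.exp_add]; simp
  have hcontr : ContractingWith (Real.toNNReal (L / l)) T := by
    refine ⟨?_, hTlip⟩
    rw [← NNReal.coe_lt_coe, Real.coe_toNNReal _ (by positivity), NNReal.coe_one,
      div_lt_one hl0]
    linarith
  set z := ContractingWith.fixedPoint T hcontr with hz
  have hfix : ∀ τ, z τ = T₀ z τ := fun τ => by
    have := hcontr.fixedPoint_isFixedPt
    exact (DFunLike.congr_fun this τ).symm
  have hYeq : ∀ τ, Y z τ = y₀ (min τ 0) + I (Y z) τ := fun τ => by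
    change y₀ (min τ 0) + Real.exp (l * max τ 0) • z τ = _
    rw [hfix τ]
    simp only [T₀, smul_smul, ← Real.exp_add, add_neg_cancel, Real.exp_zero, one_smul]
  refine ⟨Y z, hY z, fun s hs => ?_, fun τ hτ => ?_⟩
  · rw [hYeq s]; simp [I, max_eq_right hs, min_eq_left hs]
  · have h1 : HasDerivWithinAt (fun u => y₀ 0 + ∫ σ in (0 : ℝ)..u, G (Y z) σ) (F (Y z) τ)
        (Ici 0) τ := by
      have := ((hIderiv _ (hY z) τ).const_add (y₀ 0)).hasDerivWithinAt (s := Ici 0)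
      simpa only [G, max_eq_left hτ] using this
    have h2 : ∀ u ∈ Ici (0 : ℝ), Y z u = y₀ 0 + ∫ σ in (0 : ℝ)..u, G (Y z) σ := fun u hu => by
      rw [hYeq u]; simp only [I, max_eq_left (mem_Ici.1 hu), min_eq_right (mem_Ici.1 hu)]
    exact h1.congr h2 (h2 τ hτ)

/-! ### The line functional is nonexpansive for the sup norm -/

lemma lineNorm_congr {p : ℝ≥0∞} {T τ : ℝ} (hT : 0 ≤ T) {y z : ℝ → ℝ}
    (h : EqOn y z (Icc (τ - T) τ)) : lineNorm p T y τ = lineNorm p T z τ := by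
  unfold lineNorm
  split_ifs
  · congr 1
    exact image_congr fun σ hσ => by rw [h hσ]
  · congr 2
    refine intervalIntegral.integral_congr fun σ hσ => ?_
    rw [uIcc_of_le (by linarith)] at hσ
    simp only [h hσ]

/-- For a finite exponent the line functional is the `L^p` norm of the history `s ↦ y (τ - s)`
for the uniform probability measure on `[0, T]`. -/
lemma lineNorm_eq_eLpNorm {p : ℝ≥0∞} (hp : 1 ≤ p) (hp' : p ≠ ∞) {T τ : ℝ} (hT : 0 < T)
    {y : ℝ → ℝ} (hy : ContinuousOn y (Icc (τ - T) τ)) :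
    MemLp (fun s => y (τ - s)) p (ENNReal.ofReal (1 / T) • volume.restrict (Ioc 0 T)) ∧
    lineNorm p T y τ =
      (eLpNorm (fun s => y (τ - s)) p
        (ENNReal.ofReal (1 / T) • volume.restrict (Ioc 0 T))).toReal := by
  have hc : ContinuousOn (fun s => y (τ - s)) (Icc 0 T) :=
    hy.comp (by fun_prop) fun s hs => ⟨by linarith [hs.2], by linarith [hs.1]⟩
  obtain ⟨B, hB⟩ := (isCompact_Icc (a := (0:ℝ)) (b := T)).exists_bound_of_continuousOn hc
  have hmem : MemLp (fun s => y (τ - s)) p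
      (ENNReal.ofReal (1 / T) • volume.restrict (Ioc 0 T)) := by
    refine MemLp.smul_measure ?_ ENNReal.ofReal_ne_top
    refine MemLp.of_bound ((hc.mono Ioc_subset_Icc_self).aestronglyMeasurable measurableSet_Ioc) B
      ?_
    exact (ae_restrict_iff' measurableSet_Ioc).2
      (ae_of_all _ fun s hs => hB s (Ioc_subset_Icc_self hs))
  refine ⟨hmem, ?_⟩
  have hp0 : p ≠ 0 := (lt_of_lt_of_le zero_lt_one hp).ne'
  rw [hmem.eLpNorm_eq_integral_rpow_norm hp0 hp', integral_smul_measure,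
    ENNReal.toReal_ofReal (by positivity), smul_eq_mul, ENNReal.toReal_ofReal, lineNorm, if_neg hp']
  · rw [← intervalIntegral.integral_of_le hT.le,
      intervalIntegral.integral_comp_sub_left (fun s => ‖y s‖ ^ p.toReal) τ]
    simp [Real.norm_eq_abs]
  · positivity

lemma lineNorm_le_add {p : ℝ≥0∞} (hp : 1 ≤ p) {T : ℝ} (hT : 0 < T) {τ τ' D : ℝ} {y z : ℝ → ℝ}
    (hy : ContinuousOn y (Icc (τ - T) τ)) (hz : ContinuousOn z (Icc (τ' - T) τ'))
    (h : ∀ s ∈ Icc 0 T, |y (τ - s) - z (τ' - s)| ≤ D) :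
    lineNorm p T y τ ≤ lineNorm p T z τ' + D := by
  by_cases hp' : p = ∞
  · simp only [lineNorm, if_pos hp']
    refine csSup_le ((nonempty_Icc.2 (by linarith)).image _) ?_
    rintro _ ⟨σ, hσ, rfl⟩
    have h1 := h (τ - σ) ⟨by linarith [hσ.2], by linarith [hσ.1]⟩
    have h2 : |z (τ' - (τ - σ))| ≤ sSup ((fun σ => |z σ|) '' Icc (τ' - T) τ') :=
      le_csSup (isCompact_Icc.bddAbove_image hz.abs)
        ⟨_, ⟨by linarith [hσ.1], by linarith [hσ.2]⟩, rfl⟩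
    rw [sub_sub_cancel] at h1
    have h3 := abs_sub_abs_le_abs_sub (y σ) (z (τ' - (τ - σ)))
    simp only
    linarith
  · obtain ⟨hym, hye⟩ := lineNorm_eq_eLpNorm hp hp' hT hy
    obtain ⟨hzm, hze⟩ := lineNorm_eq_eLpNorm hp hp' hT hz
    set μ : Measure ℝ := ENNReal.ofReal (1 / T) • volume.restrict (Ioc 0 T) with hμ
    have hμ1 : μ univ = 1 := by
      rw [hμ, Measure.smul_apply, Measure.restrict_apply_univ, Real.volume_Ioc, smul_eq_mul,
        ← ENNReal.ofReal_mul (by positivity), sub_zero, one_div_mul_cancel hT.ne',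
        ENNReal.ofReal_one]
    have hD : 0 ≤ D := (abs_nonneg _).trans (h 0 ⟨le_rfl, hT.le⟩)
    have hdiff : eLpNorm ((fun s => y (τ - s)) - fun s => z (τ' - s)) p μ ≤ ENNReal.ofReal D := by
      have := eLpNorm_le_of_ae_bound (p := p) (μ := μ) (C := D)
        (f := (fun s => y (τ - s)) - fun s => z (τ' - s)) (by
          refine Measure.ae_smul_measure ?_ _
          refine (ae_restrict_iff' measurableSet_Ioc).2 (ae_of_all _ fun s hs => ?_)
          exact h s (Ioc_subset_Icc_self hs))
      simpa [hμ1] using this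
    have hadd := eLpNorm_add_le hzm.1 (hym.sub hzm).1 hp
    rw [add_sub_cancel] at hadd
    rw [hye, hze, ← ENNReal.toReal_ofReal hD, ← ENNReal.toReal_add hzm.2.ne ENNReal.ofReal_ne_top]
    exact ENNReal.toReal_mono (ENNReal.add_ne_top.2 ⟨hzm.2.ne, ENNReal.ofReal_ne_top⟩)
      (hadd.trans (by gcongr))

/-- Minkowski's inequality for the line functional, for two signals at two times. -/
lemma abs_lineNorm_sub_le {p : ℝ≥0∞} (hp : 1 ≤ p) {T : ℝ} (hT : 0 < T) {τ τ' D : ℝ}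
    {y z : ℝ → ℝ} (hy : ContinuousOn y (Icc (τ - T) τ)) (hz : ContinuousOn z (Icc (τ' - T) τ'))
    (h : ∀ s ∈ Icc 0 T, |y (τ - s) - z (τ' - s)| ≤ D) :
    |lineNorm p T y τ - lineNorm p T z τ'| ≤ D := by
  rw [abs_sub_le_iff]
  constructor
  · linarith [lineNorm_le_add hp hT hy hz h]
  · have := lineNorm_le_add hp hT hz hy fun s hs => by rw [abs_sub_comm]; exact h s hs
    linarith

lemma abs_lineNorm_le {p : ℝ≥0∞} (hp : 1 ≤ p) {T : ℝ} (hT : 0 < T) {τ D : ℝ}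
    {y : ℝ → ℝ} (hy : ContinuousOn y (Icc (τ - T) τ)) (h : ∀ s ∈ Icc (τ - T) τ, |y s| ≤ D) :
    |lineNorm p T y τ| ≤ D := by
  have h0 : lineNorm p T (fun _ => (0 : ℝ)) τ = 0 := by
    unfold lineNorm
    split_ifs with hp'
    · simp only [abs_zero]
      rw [(nonempty_Icc.2 (by linarith)).image_const, csSup_singleton]
    · have : 0 < p.toReal := ENNReal.toReal_pos (zero_lt_one.trans_le hp).ne' hp'
      simp [Real.zero_rpow this.ne', Real.zero_rpow (inv_pos.2 this).ne']
  have := abs_lineNorm_sub_le hp hT (z := fun _ => (0 : ℝ)) (τ' := τ) hy continuousOn_const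
    (D := D) fun s hs => by
      rw [sub_zero]; exact h _ ⟨by linarith [hs.2], by linarith [hs.1]⟩
  rwa [h0, sub_zero] at this

lemma continuous_lineNorm {p : ℝ≥0∞} (hp : 1 ≤ p) {T : ℝ} (hT : 0 < T) {y : ℝ → ℝ}
    (hy : Continuous y) : Continuous (lineNorm p T y) := by
  rw [continuous_iff_continuousAt]
  intro τ
  rw [Metric.continuousAt_iff]
  intro η hη
  have huc := (isCompact_Icc (a := τ - T - 1) (b := τ + 1)).uniformContinuousOn_of_continuous
    hy.continuousOn
  rw [Metric.uniformContinuousOn_iff] at huc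
  obtain ⟨d, hd, hd'⟩ := huc (η / 2) (by positivity)
  refine ⟨min d 1, by positivity, fun {τ'} hτ' => ?_⟩
  have h1 : |τ' - τ| < d := (lt_min_iff.1 hτ').1
  have h2 := abs_lt.1 (lt_min_iff.1 hτ').2
  have := abs_lineNorm_sub_le hp hT (τ := τ') (τ' := τ) (D := η / 2) hy.continuousOn
    hy.continuousOn fun s hs => (hd' (τ' - s) ⟨?_, ?_⟩ (τ - s) ⟨?_, ?_⟩ ?_).le
  · rw [Real.dist_eq]; linarith
  · linarith [hs.2, h2.1]
  · linarith [hs.1, h2.2]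
  · linarith [hs.2]
  · linarith [hs.1]
  · rw [Real.dist_eq, sub_sub_sub_cancel_right]; exact h1

lemma continuousOn_lineNorm {p : ℝ≥0∞} (hp : 1 ≤ p) {T : ℝ} (hT : 0 < T) {y : ℝ → ℝ} {c : ℝ}
    (hy : ContinuousOn y (Ici c)) : ContinuousOn (lineNorm p T y) (Ici (c + T)) := by
  have h1 : Continuous fun s => y (max s c) :=
    hy.comp_continuous (by fun_prop) fun s => mem_Ici.2 (le_max_right _ _)
  refine (continuous_lineNorm hp hT h1).continuousOn.congr fun τ hτ => ?_
  refine lineNorm_congr hT.le fun s hs => ?_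
  rw [mem_Ici] at hτ
  simp only [max_eq_left (show c ≤ s by linarith [hs.1])]

/-! ### An abstract two-time-scale trapping argument -/

lemma le_max_sub_of_hasDerivWithinAt_Ici {W w : ℝ → ℝ} {t₀ T b q : ℝ} (ht₀ : 0 ≤ t₀) (hq : 0 < q)
    (hd : ∀ t ∈ Icc t₀ T, HasDerivWithinAt W (w t) (Ici 0) t)
    (hw : ∀ t ∈ Icc t₀ T, b ≤ W t → w t ≤ -q) {t : ℝ} (ht : t ∈ Icc t₀ T) :
    W t ≤ max b (W t₀ - q * (t - t₀)) :=
  le_max_sub_of_deriv_le hq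
    (fun s hs => (hd s hs).continuousWithinAt.mono
      (Icc_subset_Ici_self.trans (Ici_subset_Ici.2 ht₀)))
    (fun s hs => (hd s (Ico_subset_Icc_self hs)).mono (Ici_subset_Ici.2 (ht₀.trans hs.1)))
    (fun s hs => hw s (Ico_subset_Icc_self hs)) ht

/-- A fast state `x` with Lyapunov function `W`, and a slow state `h` with tracking error `e`.
All differential inequalities are only assumed as long as `x` and `h` have stayed in the region
`‖x‖ ≤ ρ`, `2κ ≤ h ≤ u - 2κ`. The fast state settles below `r` within time `Tx`, during which,
and for a further time `d`, the slow state moves by at most `κ`. Afterwards the slow error decreases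
whenever it exceeds `b`, and the slow state is pushed away from the margins of the region. So the
region is never left. -/
theorem trapped {X : Type*} [NormedAddCommGroup X] {x : ℝ → X} {h e W w E D : ℝ → ℝ}
    {ρ κ u r W₀ b₁ q Tx d Em b q₂ : ℝ} (hκ : 0 < κ) (hq : 0 < q) (hq₂ : 0 < q₂) (hTx : 0 ≤ Tx)
    (hd : 0 ≤ d)
    (hxc : ContinuousOn x (Ici 0)) (hhc : ContinuousOn h (Ici 0))
    (hdW : ∀ τ, 0 ≤ τ → (∀ s ∈ Icc 0 τ, ‖x s‖ ≤ ρ ∧ h s ∈ Icc (2 * κ) (u - 2 * κ)) →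
      HasDerivWithinAt W (w τ) (Ici 0) τ ∧ (b₁ ≤ W τ → w τ ≤ -q) ∧ (W τ ≤ b₁ → ‖x τ‖ ≤ r) ∧
      (W τ ≤ W₀ → ‖x τ‖ < ρ))
    (hb₁ : b₁ ≤ W₀) (hW₀ : W 0 ≤ W₀) (hx₀ : ‖x 0‖ < ρ) (hset : W₀ - q * Tx ≤ b₁)
    (hdh : ∀ τ, 0 ≤ τ → (∀ s ∈ Icc 0 τ, ‖x s‖ ≤ ρ ∧ h s ∈ Icc (2 * κ) (u - 2 * κ)) →
      HasDerivWithinAt h (E τ) (Ici 0) τ ∧ HasDerivWithinAt e (E τ - D τ) (Ici 0) τ ∧ |E τ| ≤ Em)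
    (hEm : Em * (Tx + d) ≤ κ)
    (hE : ∀ τ, Tx + d ≤ τ → (∀ s ∈ Icc 0 τ, ‖x s‖ ≤ ρ ∧ h s ∈ Icc (2 * κ) (u - 2 * κ)) →
      (∀ s ∈ Icc (τ - d) τ, ‖x s‖ ≤ r) →
      (b ≤ e τ → E τ ≤ -q₂ ∧ E τ - D τ ≤ -q₂) ∧ (e τ ≤ -b → q₂ ≤ E τ ∧ q₂ ≤ E τ - D τ))
    (hlo : ∀ τ, 0 ≤ τ → h τ ≤ 3 * κ → e τ ≤ -b) (hhi : ∀ τ, 0 ≤ τ → u - 3 * κ ≤ h τ → b ≤ e τ)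
    (hh₀ : h 0 ∈ Icc (4 * κ) (u - 4 * κ)) :
    (∀ τ, 0 ≤ τ → ‖x τ‖ ≤ ρ ∧ h τ ∈ Icc (2 * κ) (u - 2 * κ)) ∧
      (∀ᶠ τ in atTop, ‖x τ‖ ≤ r) ∧ ∀ᶠ τ in atTop, |e τ| ≤ b := by
  have sub : ∀ {τ s : ℝ}, s ∈ Icc 0 τ →
      (∀ s ∈ Icc 0 τ, ‖x s‖ ≤ ρ ∧ h s ∈ Icc (2 * κ) (u - 2 * κ)) →
      ∀ s' ∈ Icc 0 s, ‖x s'‖ ≤ ρ ∧ h s' ∈ Icc (2 * κ) (u - 2 * κ) :=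
    fun hs hin s' hs' => hin s' ⟨hs'.1, hs'.2.trans hs.2⟩
  have hEm0 : ∀ τ, 0 ≤ τ → (∀ s ∈ Icc 0 τ, ‖x s‖ ≤ ρ ∧ h s ∈ Icc (2 * κ) (u - 2 * κ)) →
      W τ ≤ max b₁ (W₀ - q * τ) := fun τ hτ hin => by
    have := le_max_sub_of_hasDerivWithinAt_Ici (W := W) (w := w) (b := b₁) le_rfl hq
      (fun t ht => (hdW t ht.1 (sub ht hin)).1) (fun t ht => (hdW t ht.1 (sub ht hin)).2.1)
      (right_mem_Icc.2 hτ)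
    refine this.trans (max_le_max le_rfl ?_)
    linarith
  have hsettle : ∀ τ, Tx ≤ τ →
      (∀ s ∈ Icc 0 τ, ‖x s‖ ≤ ρ ∧ h s ∈ Icc (2 * κ) (u - 2 * κ)) → ‖x τ‖ ≤ r :=
    fun τ hτ hin => by
      refine (hdW τ (hTx.trans hτ) hin).2.2.1 ((hEm0 τ (hTx.trans hτ) hin).trans ?_)
      refine max_le le_rfl (le_trans ?_ hset)
      nlinarith
  have hslow : ∀ τ, Tx + d ≤ τ →
      (∀ s ∈ Icc 0 τ, ‖x s‖ ≤ ρ ∧ h s ∈ Icc (2 * κ) (u - 2 * κ)) →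
      (b ≤ e τ → E τ ≤ -q₂ ∧ E τ - D τ ≤ -q₂) ∧ (e τ ≤ -b → q₂ ≤ E τ ∧ q₂ ≤ E τ - D τ) :=
    fun τ hτ hin => hE τ hτ hin fun s hs =>
      hsettle s (by linarith [hs.1]) (sub ⟨by linarith [hs.1], hs.2⟩ hin)
  have hT0 : 0 ≤ Tx + d := by positivity
  have hmove : ∀ τ ∈ Icc 0 (Tx + d),
      (∀ s ∈ Icc 0 τ, ‖x s‖ ≤ ρ ∧ h s ∈ Icc (2 * κ) (u - 2 * κ)) →
      h τ ∈ Icc (3 * κ) (u - 3 * κ) := fun τ hτ hin => by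
    have hEm' : 0 ≤ Em := (abs_nonneg _).trans (hdh 0 le_rfl (sub ⟨le_rfl, hτ.1⟩ hin)).2.2
    have h1 := norm_image_sub_le_of_norm_deriv_le_segment' (f := h) (f' := E) (a := 0) (b := τ)
      (C := Em) (fun s hs => ((hdh s hs.1 (sub hs hin)).1).mono Icc_subset_Ici_self)
      (fun s hs => (hdh s hs.1 (sub (Ico_subset_Icc_self hs) hin)).2.2) τ (right_mem_Icc.2 hτ.1)
    have h2 : Em * (τ - 0) ≤ κ := le_trans (by nlinarith [hτ.2]) hEm
    have h3 := abs_le.1 (h1.trans h2)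
    exact ⟨by linarith [hh₀.1, h3.1], by linarith [hh₀.2, h3.2]⟩
  have hin : ∀ τ, 0 ≤ τ → ‖x τ‖ ≤ ρ ∧ h τ ∈ Icc (2 * κ) (u - 2 * κ) := by
    have hneg := neg_of_bootstrap
      (m := fun τ => max (‖x τ‖ - ρ) (max (2 * κ - h τ) (h τ - (u - 2 * κ)))) (by fun_prop)
      (by
        simp only [max_lt_iff]
        exact ⟨by linarith, by linarith [hh₀.1], by linarith [hh₀.2]⟩)
      (fun τ hτ hle => by
        have hin : ∀ s ∈ Icc 0 τ, ‖x s‖ ≤ ρ ∧ h s ∈ Icc (2 * κ) (u - 2 * κ) := fun s hs => by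
          have := hle s hs
          simp only [max_le_iff] at this
          exact ⟨by linarith [this.1], by linarith [this.2.1], by linarith [this.2.2]⟩
        have hx : ‖x τ‖ < ρ := (hdW τ hτ hin).2.2.2 ((hEm0 τ hτ hin).trans
          (max_le hb₁ (by nlinarith)))
        have hh : h τ ∈ Icc (3 * κ) (u - 3 * κ) := by
          rcases le_total τ (Tx + d) with hτ1 | hτ1
          · exact hmove τ ⟨hτ, hτ1⟩ hin
          · have h1 := hmove (Tx + d) (right_mem_Icc.2 hT0) (sub ⟨hT0, hτ1⟩ hin)
            have up := le_max_sub_of_hasDerivWithinAt_Ici (W := h) (w := E) (b := u - 3 * κ)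
              hT0 hq₂
              (fun t ht => (hdh t (hT0.trans ht.1) (sub ⟨hT0.trans ht.1, ht.2⟩ hin)).1)
              (fun t ht hb => ((hslow t ht.1 (sub ⟨hT0.trans ht.1, ht.2⟩ hin)).1
                (hhi t (hT0.trans ht.1) hb)).1) (right_mem_Icc.2 hτ1)
            have dn := le_max_sub_of_hasDerivWithinAt_Ici (W := fun s => -h s) (w := fun s => -E s)
              (b := -(3 * κ)) hT0 hq₂
              (fun t ht => (hdh t (hT0.trans ht.1) (sub ⟨hT0.trans ht.1, ht.2⟩ hin)).1.neg)
              (fun t ht hb => neg_le_neg ((hslow t ht.1 (sub ⟨hT0.trans ht.1, ht.2⟩ hin)).2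
                (hlo t (hT0.trans ht.1) (neg_le_neg_iff.1 hb))).1) (right_mem_Icc.2 hτ1)
            have hp : 0 ≤ q₂ * (τ - (Tx + d)) := mul_nonneg hq₂.le (by linarith)
            constructor
            · have := dn.trans (max_le le_rfl (by linarith [h1.1]))
              linarith
            · exact up.trans (max_le le_rfl (by linarith [h1.2]))
        simp only [max_lt_iff]
        exact ⟨by linarith, by linarith [hh.1], by linarith [hh.2]⟩)
    intro τ hτ
    have := hneg τ hτ
    simp only [max_lt_iff] at this
    exact ⟨by linarith [this.1], by linarith [this.2.1], by linarith [this.2.2]⟩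
  refine ⟨hin, ?_, ?_⟩
  · filter_upwards [eventually_ge_atTop Tx] with τ hτ
    exact hsettle τ hτ fun s hs => hin s hs.1
  · have hlim : Tendsto (fun τ => q₂ * (τ - (Tx + d))) atTop atTop :=
      (tendsto_atTop_add_const_right _ _ tendsto_id).const_mul_atTop hq₂
    filter_upwards [eventually_ge_atTop (Tx + d),
      hlim.eventually_ge_atTop (|e (Tx + d)| - b)] with τ hτ hτ'
    have up := le_max_sub_of_hasDerivWithinAt_Ici (W := e) (w := fun s => E s - D s) (b := b)
      hT0 hq₂ (fun t ht => (hdh t (hT0.trans ht.1) fun s hs => hin s hs.1).2.1)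
      (fun t ht hb => ((hslow t ht.1 fun s hs => hin s hs.1).1 hb).2) (right_mem_Icc.2 hτ)
    have dn := le_max_sub_of_hasDerivWithinAt_Ici (W := fun s => -e s)
      (w := fun s => -(E s - D s)) (b := b)
      hT0 hq₂ (fun t ht => (hdh t (hT0.trans ht.1) fun s hs => hin s hs.1).2.1.neg)
      (fun t ht hb => neg_le_neg ((hslow t ht.1 fun s hs => hin s hs.1).2 (le_neg_of_le_neg hb)).2)
      (right_mem_Icc.2 hτ)
    have h1 := le_abs_self (e (Tx + d))
    have h2 := neg_abs_le (e (Tx + d))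
    rw [abs_le]
    constructor
    · have := dn.trans (max_le le_rfl (by linarith))
      linarith
    · exact up.trans (max_le le_rfl (by linarith))

/-! ### Averaging over one dither period -/

/-- Correlating `A + B a sin(ωσ)` with the delayed dither over one period leaves the gradient
`B`, up to the phase factor `cos(ωφ)`. -/
lemma integral_dither {ω : ℝ} (hω : ω ≠ 0) (A B φ τ : ℝ) :
    ∫ σ in (τ - 2 * Real.pi / ω)..τ, (A + B * Real.sin (ω * σ)) * Real.sin (ω * (σ - φ)) =
      B * (Real.pi / ω) * Real.cos (ω * φ) := by
  have hder : ∀ σ ∈ uIcc (τ - 2 * Real.pi / ω) τ,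
      HasDerivAt (fun σ => -(A / ω) * Real.cos (ω * (σ - φ)) + B / 2 * (Real.cos (ω * φ) * σ -
        1 / (2 * ω) * Real.sin (2 * (ω * σ) - ω * φ)))
      ((A + B * Real.sin (ω * σ)) * Real.sin (ω * (σ - φ))) σ := fun σ _ => by
    have h1 : HasDerivAt (fun σ => ω * (σ - φ)) ω σ := by
      simpa using ((hasDerivAt_id σ).sub_const φ).const_mul ω
    have h2 : HasDerivAt (fun σ => 2 * (ω * σ) - ω * φ) (2 * ω) σ := by
      simpa using ((((hasDerivAt_id σ).const_mul ω)).const_mul 2).sub_const (ω * φ)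
    have h3 : HasDerivAt (fun σ => Real.cos (ω * φ) * σ) (Real.cos (ω * φ)) σ := by
      simpa using (hasDerivAt_id σ).const_mul (Real.cos (ω * φ))
    have h := (h1.cos.const_mul (-(A / ω))).add
      ((h3.sub (h2.sin.const_mul (1 / (2 * ω)))).const_mul (B / 2))
    refine h.congr_deriv ?_
    have e1 : 2 * (ω * σ) - ω * φ = ω * σ + (ω * σ - ω * φ) := by ring
    have e2 : ω * φ = ω * σ - (ω * σ - ω * φ) := by ring
    rw [mul_sub, e1, Real.cos_add]
    nth_rewrite 2 [e2]
    rw [Real.cos_sub]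
    field_simp
    ring
  rw [intervalIntegral.integral_eq_sub_of_hasDerivAt hder
    (Continuous.intervalIntegrable (by fun_prop) _ _)]
  have e1 : ω * (τ - 2 * Real.pi / ω - φ) = ω * (τ - φ) - 2 * Real.pi := by
    field_simp
    ring
  have e2 : 2 * (ω * (τ - 2 * Real.pi / ω)) - ω * φ =
      2 * (ω * τ) - ω * φ - (2 : ℕ) * (2 * Real.pi) := by
    push_cast; field_simp; ring
  rw [e1, e2, Real.cos_sub_two_pi, Real.sin_sub_nat_mul_two_pi]
  field_simp
  ring

lemma abs_average_sub_le {g : ℝ → ℝ} {a ω δ A B φ τ η : ℝ} (ha : 0 < a) (hω : 0 < ω) (hδ : 0 < δ)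
    (hg : ContinuousOn g (Icc (τ - 2 * Real.pi / ω) τ))
    (h : ∀ σ ∈ Icc (τ - 2 * Real.pi / ω) τ, |g σ - (A + B * (a * Real.sin (ω * σ)))| ≤ η * a) :
    |a * ω ^ 2 * δ / Real.pi *
        (∫ σ in (τ - 2 * Real.pi / ω)..τ, g σ * Real.sin (ω * (σ - φ))) -
      a ^ 2 * ω * δ * (B * Real.cos (ω * φ))| ≤ a ^ 2 * ω * δ * (2 * η) := by
  have hpi := Real.pi_pos
  have hle : τ - 2 * Real.pi / ω ≤ τ := by
    have : 0 < 2 * Real.pi / ω := by positivity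
    linarith
  have hi1 : IntervalIntegrable (fun σ => g σ * Real.sin (ω * (σ - φ))) volume
      (τ - 2 * Real.pi / ω) τ := by
    refine ContinuousOn.intervalIntegrable ?_
    rw [uIcc_of_le hle]
    exact hg.mul (by fun_prop)
  have hi2 : IntervalIntegrable (fun σ => (A + B * a * Real.sin (ω * σ)) * Real.sin (ω * (σ - φ)))
      volume (τ - 2 * Real.pi / ω) τ := Continuous.intervalIntegrable (by fun_prop) _ _
  have hb := intervalIntegral.norm_integral_le_of_norm_le_const (a := τ - 2 * Real.pi / ω) (b := τ)
    (C := η * a) (f := fun σ => g σ * Real.sin (ω * (σ - φ)) -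
      (A + B * a * Real.sin (ω * σ)) * Real.sin (ω * (σ - φ))) fun σ hσ => by
        rw [uIoc_of_le hle] at hσ
        rw [← sub_mul, norm_mul, Real.norm_eq_abs, Real.norm_eq_abs]
        have h1 := h σ (Ioc_subset_Icc_self hσ)
        have h2 := Real.abs_sin_le_one (ω * (σ - φ))
        rw [← mul_assoc] at h1
        nlinarith [abs_nonneg (g σ - (A + B * a * Real.sin (ω * σ)))]
  rw [intervalIntegral.integral_sub hi1 hi2, integral_dither hω.ne', Real.norm_eq_abs,
    sub_sub_cancel, abs_of_pos (by positivity : 0 < 2 * Real.pi / ω)] at hb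
  have hk : 0 < a * ω ^ 2 * δ / Real.pi := by positivity
  have := mul_le_mul_of_nonneg_left hb hk.le
  rw [← abs_of_pos hk, ← abs_mul, abs_of_pos hk] at this
  have e1 : a * ω ^ 2 * δ / Real.pi *
        ((∫ σ in (τ - 2 * Real.pi / ω)..τ, g σ * Real.sin (ω * (σ - φ))) -
          B * a * (Real.pi / ω) * Real.cos (ω * φ)) =
      a * ω ^ 2 * δ / Real.pi *
        (∫ σ in (τ - 2 * Real.pi / ω)..τ, g σ * Real.sin (ω * (σ - φ))) -
      a ^ 2 * ω * δ * (B * Real.cos (ω * φ)) := by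
    field_simp
  have e2 : a * ω ^ 2 * δ / Real.pi * (η * a * (2 * Real.pi / ω)) =
      a ^ 2 * ω * δ * (2 * η) := by
    field_simp
  rwa [e1, e2] at this

/-! ### The performance output -/

lemma continuous_exoFlow {n : ℕ} (A : Matrix (Fin n) (Fin n) ℝ) (ξ₀ : EuclideanSpace ℝ (Fin n)) :
    Continuous (exoFlow A ξ₀) := by
  unfold exoFlow
  exact continuous_iff_continuousAt.2 fun τ =>
    (((hasDerivAt_exp_smul_const (𝕂 := ℝ)
      (Matrix.toEuclideanCLM (n := Fin n) (𝕜 := ℝ) A) τ).continuousAt).clm_apply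
      continuousAt_const)

namespace System

variable {nr no nc nzo nzc : ℕ} {S : System nr no nc nzo nzc}
  {M : EuclideanSpace ℝ (Fin nr) → ℝ → ℝ → State no nc nzo nzc} {εbar Nmin : ℝ}

lemma continuous_ξr (N : ℝ) (ξ₀ : EuclideanSpace ℝ (Fin nr)) : Continuous (S.ξr N ξ₀) :=
  continuous_exoFlow _ _

lemma contDiff_hz (hfs : ContDiff ℝ 2 S.fs) : ContDiff ℝ 2 S.hz := by
  unfold hz dotProduct
  refine ContDiff.add (by fun_prop) (hfs.comp ?_)
  rw [contDiff_euclidean]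
  intro i
  simp only [Matrix.mulVec, dotProduct]
  fun_prop

lemma continuous_M (hss : S.SteadyStateAssumption M εbar Nmin) {N : ℝ} (hN : Nmin ≤ N) :
    Continuous fun z : EuclideanSpace ℝ (Fin nr) × ℝ => M z.1 z.2 N :=
  (hss.smooth N hN).continuous

lemma differentiable_M (hss : S.SteadyStateAssumption M εbar Nmin) {N : ℝ} (hN : Nmin ≤ N)
    (ξ : EuclideanSpace ℝ (Fin nr)) : Differentiable ℝ fun ε => M ξ ε N :=
  ((hss.smooth N hN).comp (contDiff_prodMk_right ξ)).differentiable (by norm_num)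

/-- The regulation error `h_z(x̃ + M)` is bounded and Lipschitz in `(x̃, ε)` on bounded sets,
uniformly in `N` and in the reference. -/
lemma exists_signal_bound (href : S.ReferenceAssumption Nmin)
    (hreg : S.RegularityAssumption εbar Nmin) (hss : S.SteadyStateAssumption M εbar Nmin) (K : ℝ) :
    ∃ C, 0 < C ∧ ∀ N, Nmin ≤ N → ∀ ξ₀ ∈ S.Dr, ∀ τ x x' ε ε', ‖x‖ ≤ K → ‖x'‖ ≤ K → |ε| ≤ K →
      |ε'| ≤ K → |S.hz (x + M (S.ξr N ξ₀ τ) ε N)| ≤ C ∧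
      |S.hz (x + M (S.ξr N ξ₀ τ) ε N) - S.hz (x' + M (S.ξr N ξ₀ τ) ε' N)| ≤
        C * (‖x - x'‖ + |ε - ε'|) := by
  obtain ⟨R, hR⟩ := href.bounded
  obtain ⟨CM, hCM⟩ := hss.locally_bounded (max R K)
  have hcd := contDiff_hz hreg.fs_smooth
  have hcomp := isCompact_closedBall (0 : State no nc nzo nzc) (K + CM)
  obtain ⟨B, hB⟩ := hcomp.exists_bound_of_continuousOn hcd.continuous.continuousOn
  obtain ⟨Lz, hLz⟩ := hcd.contDiffOn.exists_lipschitzOnWith (n := 2) (by norm_num)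
    (convex_closedBall (0 : State no nc nzo nzc) (K + CM)) hcomp
  refine ⟨|B| + Lz * (1 + |CM|) + 1, by positivity, ?_⟩
  intro N hN ξ₀ hξ₀ τ x x' ε ε' hx hx' hε hε'
  have hξ : ‖S.ξr N ξ₀ τ‖ ≤ max R K := (hR N hN ξ₀ hξ₀ τ).trans (le_max_left _ _)
  have hM : ∀ η, |η| ≤ K → ‖M (S.ξr N ξ₀ τ) η N‖ ≤ CM ∧
      ‖deriv (fun η => M (S.ξr N ξ₀ τ) η N) η‖ ≤ CM :=
    fun η hη => hCM N hN _ hξ η (hη.trans (le_max_right _ _))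
  have hmem : ∀ y η, ‖y‖ ≤ K → |η| ≤ K →
      y + M (S.ξr N ξ₀ τ) η N ∈ Metric.closedBall (0 : State no nc nzo nzc) (K + CM) :=
    fun y η hy hη => by
      rw [mem_closedBall_zero_iff]
      exact (norm_add_le _ _).trans (add_le_add hy (hM η hη).1)
  have hMl : ‖M (S.ξr N ξ₀ τ) ε N - M (S.ξr N ξ₀ τ) ε' N‖ ≤ CM * ‖ε - ε'‖ :=
    (convex_Icc (-K) K).norm_image_sub_le_of_norm_deriv_le (f := fun η => M (S.ξr N ξ₀ τ) η N)
      (fun η _ => (differentiable_M hss hN _) η) (fun η hη => (hM η (abs_le.2 hη)).2)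
      (abs_le.1 hε') (abs_le.1 hε)
  have h0 : (0 : ℝ) ≤ Lz := Lz.2
  have hCM0 := le_abs_self CM
  constructor
  · have := hB _ (hmem x ε hx hε)
    rw [Real.norm_eq_abs] at this
    have h2 := le_abs_self B
    have h3 : 0 ≤ Lz * (1 + |CM|) := by positivity
    linarith
  · have h1 := hLz.dist_le_mul _ (hmem x ε hx hε) _ (hmem x' ε' hx' hε')
    rw [Real.dist_eq, dist_eq_norm, add_sub_add_comm] at h1
    have h2 : ‖x - x' + (M (S.ξr N ξ₀ τ) ε N - M (S.ξr N ξ₀ τ) ε' N)‖ ≤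
        (1 + |CM|) * (‖x - x'‖ + |ε - ε'|) := by
      refine (norm_add_le _ _).trans ?_
      rw [Real.norm_eq_abs] at hMl
      nlinarith [norm_nonneg (x - x'), abs_nonneg (ε - ε'), abs_nonneg CM,
        mul_nonneg (abs_nonneg CM) (norm_nonneg (x - x')),
        mul_nonneg (sub_nonneg.2 hCM0) (abs_nonneg (ε - ε'))]
    refine h1.trans ((mul_le_mul_of_nonneg_left h2 h0).trans ?_)
    rw [← mul_assoc]
    refine mul_le_mul_of_nonneg_right ?_ (by positivity)
    linarith [abs_nonneg B]

lemma continuousOn_signal (hreg : S.RegularityAssumption εbar Nmin)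
    (hss : S.SteadyStateAssumption M εbar Nmin) {N : ℝ} (hN : Nmin ≤ N)
    (ξ₀ : EuclideanSpace ℝ (Fin nr)) {x : ℝ → State no nc nzo nzc} {eps : ℝ → ℝ} {A : Set ℝ}
    (hx : ContinuousOn x A) (he : ContinuousOn eps A) :
    ContinuousOn (fun s => S.hz (x s + M (S.ξr N ξ₀ s) (eps s) N)) A :=
  (contDiff_hz hreg.fs_smooth).continuous.comp_continuousOn
    (hx.add ((continuous_M hss hN).comp_continuousOn ((continuous_ξr N ξ₀).continuousOn.prodMk he)))

lemma continuousOn_J (hreg : S.RegularityAssumption εbar Nmin)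
    (hss : S.SteadyStateAssumption M εbar Nmin) {N : ℝ} (hN : Nmin ≤ N)
    (ξ₀ : EuclideanSpace ℝ (Fin nr)) {x : ℝ → State no nc nzo nzc} {eps : ℝ → ℝ} {c : ℝ}
    (hx : ContinuousOn x (Ici c)) (he : ContinuousOn eps (Ici c)) :
    ContinuousOn (S.J M N ξ₀ x eps) (Ici (c + S.Tl)) := by
  unfold J
  refine (hreg.ge_smooth.continuous.comp_continuousOn (continuousOn_lineNorm S.one_le_p S.Tl_pos
    (continuousOn_signal hreg hss hN ξ₀ hx he))).add
    (hreg.gs_smooth.continuous.comp_continuousOn (he.comp (by fun_prop) fun σ hσ => ?_))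
  have h1 := S.τφ_mem.2
  rw [mem_Ici] at hσ ⊢
  linarith

lemma J_congr {N σ : ℝ} {ξ₀ : EuclideanSpace ℝ (Fin nr)} {x x' : ℝ → State no nc nzo nzc}
    {eps eps' : ℝ → ℝ} (hx : EqOn x x' (Icc (σ - S.Tl) σ))
    (he : EqOn eps eps' (Icc (σ - S.Tl) σ)) : S.J M N ξ₀ x eps σ = S.J M N ξ₀ x' eps' σ := by
  unfold J
  rw [lineNorm_congr S.Tl_pos.le fun s hs => ?_, he ⟨by linarith [S.τφ_mem.2],
    by linarith [S.τφ_mem.1]⟩]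
  simp only [hx hs, he hs]

lemma adaptRate_congr {a ω δ N τ : ℝ} (hω : 0 < ω) {ξ₀ : EuclideanSpace ℝ (Fin nr)}
    {x x' : ℝ → State no nc nzo nzc} {eps eps' : ℝ → ℝ} (hx : EqOn x x' (Icc (τ - S.τd ω) τ))
    (he : EqOn eps eps' (Icc (τ - S.τd ω) τ)) :
    S.adaptRate M a ω δ N ξ₀ x eps τ = S.adaptRate M a ω δ N ξ₀ x' eps' τ := by
  have hP : 0 < 2 * Real.pi / ω := by positivity
  unfold adaptRate
  congr 1
  refine intervalIntegral.integral_congr fun σ hσ => ?_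
  rw [uIcc_of_le (by linarith)] at hσ
  have hsub : Icc (σ - S.Tl) σ ⊆ Icc (τ - S.τd ω) τ :=
    Icc_subset_Icc (by unfold τd; linarith [hσ.1]) hσ.2
  simp only [J_congr (hx.mono hsub) (he.mono hsub)]

/-- The steady-state map is the performance output of a vanishing error and a constant scan
rate. -/
lemma J_zero_const (N : ℝ) (ξ₀ : EuclideanSpace ℝ (Fin nr)) (ε σ : ℝ) :
    S.J M N ξ₀ (fun _ => 0) (fun _ => ε) σ = S.Jbar M ξ₀ ε N σ := by
  simp [J, Jbar]

/-- On histories bounded by `K`, the performance output is bounded by `C`, and Lipschitz with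
constant `C` for the sup norm over the window that it depends on. -/
def OutputBound (S : System nr no nc nzo nzc)
    (M : EuclideanSpace ℝ (Fin nr) → ℝ → ℝ → State no nc nzo nzc) (N : ℝ)
    (ξ₀ : EuclideanSpace ℝ (Fin nr)) (K C : ℝ) : Prop :=
  ∀ σ x eps, ContinuousOn x (Icc (σ - S.Tl) σ) → ContinuousOn eps (Icc (σ - S.Tl) σ) →
    (∀ s ∈ Icc (σ - S.Tl) σ, ‖x s‖ ≤ K ∧ |eps s| ≤ K) →
    |S.J M N ξ₀ x eps σ| ≤ C ∧
    ∀ x' eps', ContinuousOn x' (Icc (σ - S.Tl) σ) → ContinuousOn eps' (Icc (σ - S.Tl) σ) →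
      (∀ s ∈ Icc (σ - S.Tl) σ, ‖x' s‖ ≤ K ∧ |eps' s| ≤ K) → ∀ D,
      (∀ s ∈ Icc (σ - S.Tl) σ, ‖x s - x' s‖ ≤ D ∧ |eps s - eps' s| ≤ D) →
      |S.J M N ξ₀ x eps σ - S.J M N ξ₀ x' eps' σ| ≤ C * D

/-- The bounds of `OutputBound` are uniform in `N` and in the reference. -/
lemma exists_outputBound (href : S.ReferenceAssumption Nmin)
    (hreg : S.RegularityAssumption εbar Nmin) (hss : S.SteadyStateAssumption M εbar Nmin) (K : ℝ) :
    ∃ C, 0 < C ∧ ∀ N, Nmin ≤ N → ∀ ξ₀ ∈ S.Dr, S.OutputBound M N ξ₀ K C := by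
  obtain ⟨C, hC, hsig⟩ := exists_signal_bound href hreg hss K
  obtain ⟨Be, hBe⟩ := (isCompact_Icc (a := -C) (b := C)).exists_bound_of_continuousOn
    hreg.ge_smooth.continuous.continuousOn
  obtain ⟨Le, hLe⟩ := hreg.ge_smooth.contDiffOn.exists_lipschitzOnWith (n := 2) (by norm_num)
    (convex_Icc (-C) C) isCompact_Icc
  obtain ⟨Bs, hBs⟩ := (isCompact_Icc (a := -K) (b := K)).exists_bound_of_continuousOn
    hreg.gs_smooth.continuous.continuousOn
  obtain ⟨Ls, hLs⟩ := hreg.gs_smooth.contDiffOn.exists_lipschitzOnWith (n := 2) (by norm_num)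
    (convex_Icc (-K) K) isCompact_Icc
  have hLe0 : (0 : ℝ) ≤ Le := Le.2
  have hLs0 : (0 : ℝ) ≤ Ls := Ls.2
  refine ⟨|Be| + |Bs| + Le * (C * 2) + Ls + 1, by positivity, ?_⟩
  intro N hN ξ₀ hξ₀ σ x eps hx he hb
  have hline : ∀ (y : ℝ → State no nc nzo nzc) (η : ℝ → ℝ), ContinuousOn y (Icc (σ - S.Tl) σ) →
      ContinuousOn η (Icc (σ - S.Tl) σ) → (∀ s ∈ Icc (σ - S.Tl) σ, ‖y s‖ ≤ K ∧ |η s| ≤ K) →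
      lineNorm S.p S.Tl (fun s => S.hz (y s + M (S.ξr N ξ₀ s) (η s) N)) σ ∈ Icc (-C) C :=
    fun y η hy hη hyη => abs_le.1 (abs_lineNorm_le S.one_le_p S.Tl_pos
      (continuousOn_signal hreg hss hN ξ₀ hy hη) fun s hs => (hsig N hN ξ₀ hξ₀ s (y s) (y s) (η s)
        (η s) (hyη s hs).1 (hyη s hs).1 (hyη s hs).2 (hyη s hs).2).1)
  have hφ : σ - S.τφ ∈ Icc (σ - S.Tl) σ :=
    ⟨by linarith [S.τφ_mem.2], by linarith [S.τφ_mem.1]⟩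
  constructor
  · have h1 := hBe _ (hline x eps hx he hb)
    have h2 := hBs _ (abs_le.1 (hb _ hφ).2)
    rw [Real.norm_eq_abs] at h1 h2
    unfold J
    refine (abs_add_le _ _).trans ((add_le_add h1 h2).trans ?_)
    have h3 : 0 ≤ Le * (C * 2) := by positivity
    linarith [le_abs_self Be, le_abs_self Bs]
  · intro x' eps' hx' he' hb' D hD
    have hD0 : 0 ≤ D := (abs_nonneg _).trans (hD _ hφ).2
    have h1 := hLe.dist_le_mul _ (hline x eps hx he hb) _ (hline x' eps' hx' he' hb')
    have h2 := hLs.dist_le_mul _ (abs_le.1 (hb _ hφ).2) _ (abs_le.1 (hb' _ hφ).2)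
    have h3 := abs_lineNorm_sub_le S.one_le_p S.Tl_pos (τ := σ) (τ' := σ) (D := C * (D + D))
      (continuousOn_signal hreg hss hN ξ₀ hx he) (continuousOn_signal hreg hss hN ξ₀ hx' he')
      fun s hs => by
        have hs' : σ - s ∈ Icc (σ - S.Tl) σ := ⟨by linarith [hs.2], by linarith [hs.1]⟩
        refine (hsig N hN ξ₀ hξ₀ _ _ _ _ _ (hb _ hs').1 (hb' _ hs').1 (hb _ hs').2
          (hb' _ hs').2).2.trans ?_
        have := hD _ hs'
        gcongr
        · exact this.1
        · exact this.2
    rw [Real.dist_eq, Real.dist_eq] at h1 h2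
    unfold J
    rw [add_sub_add_comm]
    refine (abs_add_le _ _).trans ?_
    have h4 := mul_le_mul_of_nonneg_left h3 hLe0
    have h5 := mul_le_mul_of_nonneg_left (hD _ hφ).2 hLs0
    have h6 := mul_nonneg (add_nonneg (abs_nonneg Be) (abs_nonneg Bs)) hD0
    nlinarith

lemma abs_adaptRate_le {a ω δ N C τ : ℝ} (ha : 0 < a) (hω : 0 < ω) (hδ : 0 < δ)
    {ξ₀ : EuclideanSpace ℝ (Fin nr)} {x : ℝ → State no nc nzo nzc} {eps : ℝ → ℝ}
    (h : ∀ σ ∈ Icc (τ - 2 * Real.pi / ω) τ, |S.J M N ξ₀ x eps σ| ≤ C) :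
    |S.adaptRate M a ω δ N ξ₀ x eps τ| ≤ 2 * a * ω * δ * C := by
  have hP : 0 < 2 * Real.pi / ω := by positivity
  have hb := intervalIntegral.norm_integral_le_of_norm_le_const (a := τ - 2 * Real.pi / ω) (b := τ)
    (C := C) (f := fun σ => S.J M N ξ₀ x eps σ * Real.sin (ω * (σ - S.τφ))) fun σ hσ => by
      rw [uIoc_of_le (by linarith)] at hσ
      rw [norm_mul, Real.norm_eq_abs, Real.norm_eq_abs]
      have h1 := h σ (Ioc_subset_Icc_self hσ)
      have h2 := Real.abs_sin_le_one (ω * (σ - S.τφ))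
      nlinarith [abs_nonneg (S.J M N ξ₀ x eps σ)]
  rw [Real.norm_eq_abs, sub_sub_cancel, abs_of_pos hP] at hb
  have hk : 0 < a * ω ^ 2 * δ / Real.pi := by positivity
  unfold adaptRate
  rw [abs_mul, abs_of_pos hk]
  refine (mul_le_mul_of_nonneg_left hb hk.le).trans (le_of_eq ?_)
  field_simp

/-- The adaptation rate is Lipschitz in the performance output. -/
lemma abs_adaptRate_sub_le {a ω δ N C τ : ℝ} (ha : 0 < a) (hω : 0 < ω) (hδ : 0 < δ)
    {ξ₀ : EuclideanSpace ℝ (Fin nr)} {x x' : ℝ → State no nc nzo nzc} {eps eps' : ℝ → ℝ}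
    (hc : ContinuousOn (S.J M N ξ₀ x eps) (Icc (τ - 2 * Real.pi / ω) τ))
    (hc' : ContinuousOn (S.J M N ξ₀ x' eps') (Icc (τ - 2 * Real.pi / ω) τ))
    (h : ∀ σ ∈ Icc (τ - 2 * Real.pi / ω) τ,
      |S.J M N ξ₀ x eps σ - S.J M N ξ₀ x' eps' σ| ≤ C) :
    |S.adaptRate M a ω δ N ξ₀ x eps τ - S.adaptRate M a ω δ N ξ₀ x' eps' τ| ≤
      2 * a * ω * δ * C := by
  have hP : 0 < 2 * Real.pi / ω := by positivity
  have hi : ∀ {g : ℝ → ℝ}, ContinuousOn g (Icc (τ - 2 * Real.pi / ω) τ) →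
      IntervalIntegrable (fun σ => g σ * Real.sin (ω * (σ - S.τφ))) volume
        (τ - 2 * Real.pi / ω) τ := fun hg => by
    refine ContinuousOn.intervalIntegrable ?_
    rw [uIcc_of_le (by linarith)]
    exact hg.mul (by fun_prop)
  have hb := intervalIntegral.norm_integral_le_of_norm_le_const (a := τ - 2 * Real.pi / ω) (b := τ)
    (C := C) (f := fun σ => S.J M N ξ₀ x eps σ * Real.sin (ω * (σ - S.τφ)) -
      S.J M N ξ₀ x' eps' σ * Real.sin (ω * (σ - S.τφ))) fun σ hσ => by
      rw [uIoc_of_le (by linarith)] at hσ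
      rw [← sub_mul, norm_mul, Real.norm_eq_abs, Real.norm_eq_abs]
      have h1 := h σ (Ioc_subset_Icc_self hσ)
      have h2 := Real.abs_sin_le_one (ω * (σ - S.τφ))
      nlinarith [abs_nonneg (S.J M N ξ₀ x eps σ - S.J M N ξ₀ x' eps' σ)]
  rw [intervalIntegral.integral_sub (hi hc) (hi hc'), Real.norm_eq_abs, sub_sub_cancel,
    abs_of_pos hP] at hb
  have hk : 0 < a * ω ^ 2 * δ / Real.pi := by positivity
  unfold adaptRate
  rw [← mul_sub, abs_mul, abs_of_pos hk]
  refine (mul_le_mul_of_nonneg_left hb hk.le).trans (le_of_eq ?_)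
  field_simp

/-- Taylor estimate of first order for a function with bounded second derivative. -/
lemma abs_sub_sub_deriv_mul_le {g : ℝ → ℝ} {l u B x y : ℝ}
    (hd : ∀ z ∈ Ioo l u, DifferentiableAt ℝ g z ∧ DifferentiableAt ℝ (deriv g) z ∧
      |deriv (deriv g) z| ≤ B) (hx : x ∈ Ioo l u) (hy : y ∈ Ioo l u) :
    |g y - (g x + deriv g x * (y - x))| ≤ B * (y - x) ^ 2 := by
  have hsub : uIcc x y ⊆ Ioo l u := (ordConnected_Ioo).uIcc_subset hx hy
  have hB : 0 ≤ B := (abs_nonneg _).trans (hd x hx).2.2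
  have hg' : ∀ z ∈ uIcc x y, ‖deriv (fun z => g z - deriv g x * z) z‖ ≤ B * |y - x| :=
    fun z hz => by
      have h1 : deriv (fun z => g z - deriv g x * z) z = deriv g z - deriv g x := by
        have : HasDerivAt (fun z => g z - deriv g x * z) (deriv g z - deriv g x * 1) z :=
          (hd z (hsub hz)).1.hasDerivAt.sub ((hasDerivAt_id z).const_mul (deriv g x))
        rw [this.deriv, mul_one]
      rw [h1]
      have h2 := (convex_Ioo l u).norm_image_sub_le_of_norm_deriv_le (f := deriv g)
        (fun w hw => (hd w hw).2.1) (fun w hw => (hd w hw).2.2) hx (hsub hz)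
      refine h2.trans ?_
      rw [Real.norm_eq_abs]
      exact mul_le_mul_of_nonneg_left (abs_sub_left_of_mem_uIcc hz) hB
  have h := (convex_uIcc x y).norm_image_sub_le_of_norm_deriv_le
    (f := fun z => g z - deriv g x * z) (fun z hz => by
      have := (hd z (hsub hz)).1
      fun_prop) hg' left_mem_uIcc right_mem_uIcc
  rw [Real.norm_eq_abs, Real.norm_eq_abs, mul_assoc, abs_mul_abs_self] at h
  convert h using 2 <;> ring

end System

/-! ### A priori bounds for the closed loop -/

lemma abs_sub_le_of_hasDerivWithinAt_Ici {f f' : ℝ → ℝ} {C s t : ℝ} (hs : 0 ≤ s) (hst : s ≤ t)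
    (hd : ∀ u ∈ Icc s t, HasDerivWithinAt f (f' u) (Ici 0) u ∧ |f' u| ≤ C) :
    |f t - f s| ≤ C * (t - s) :=
  norm_image_sub_le_of_norm_deriv_le_segment'
    (fun u hu => (hd u hu).1.mono (Icc_subset_Ici_self.trans (Ici_subset_Ici.2 hs)))
    (fun u hu => (hd u (Ico_subset_Icc_self hu)).2) t (right_mem_Icc.2 hst)

/-- Decay of a parameter-dependent Lyapunov function `U (x, ε)` when the parameter drifts at
rate `v`, and the drift moves the equilibrium by `v • m`. -/
lemma hasDerivWithinAt_lyapunov {X : Type*} [NormedAddCommGroup X] [NormedSpace ℝ X]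
    {U : X × ℝ → ℝ} {x : ℝ → X} {eps : ℝ → ℝ} {τ v C : ℝ} {f₀ m : X}
    (hU : DifferentiableAt ℝ U (x τ, eps τ)) (hx : HasDerivWithinAt x (f₀ - v • m) (Ici 0) τ)
    (he : HasDerivWithinAt eps v (Ici 0) τ) (hC : ‖fderiv ℝ U (x τ, eps τ)‖ ≤ C) :
    HasDerivWithinAt (fun s => U (x s, eps s)) (fderiv ℝ U (x τ, eps τ) (f₀ - v • m, v)) (Ici 0) τ ∧
    fderiv ℝ U (x τ, eps τ) (f₀ - v • m, v) ≤
      fderiv ℝ (fun y => U (y, eps τ)) (x τ) f₀ + C * (|v| * (‖m‖ + 1)) := by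
  refine ⟨hU.hasFDerivAt.comp_hasDerivWithinAt τ (hx.prodMk he), ?_⟩
  have h1 : fderiv ℝ (fun y => U (y, eps τ)) (x τ) f₀ = fderiv ℝ U (x τ, eps τ) (f₀, 0) := by
    have := hU.hasFDerivAt.comp (x τ) (hasFDerivAt_prodMk_left (𝕜 := ℝ) (x τ) (eps τ))
    rw [show (fun y => U (y, eps τ)) = U ∘ fun y => (y, eps τ) from rfl, this.fderiv]
    simp
  have h2 : ((f₀ - v • m, v) : X × ℝ) = (f₀, 0) + (-(v • m), v) := by
    simp [sub_eq_add_neg]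
  rw [h1, h2, map_add]
  refine add_le_add le_rfl ((le_abs_self _).trans ?_)
  refine ((fderiv ℝ U (x τ, eps τ)).le_of_opNorm_le hC _).trans ?_
  have hC0 : 0 ≤ C := (norm_nonneg _).trans hC
  refine mul_le_mul_of_nonneg_left ?_ hC0
  rw [mul_add, mul_one, Prod.norm_def, norm_neg, norm_smul, Real.norm_eq_abs]
  have hvm : 0 ≤ |v| * ‖m‖ := by positivity
  exact max_le (by linarith [abs_nonneg v]) (by linarith)

namespace System

variable {nr no nc nzo nzc : ℕ} {S : System nr no nc nzo nzc}
  {M : EuclideanSpace ℝ (Fin nr) → ℝ → ℝ → State no nc nzo nzc}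
  {εstar : EuclideanSpace ℝ (Fin nr) → ℝ → ℝ → ℝ} {εbar Nmin : ℝ}

/-- `(x, e)` obeys the closed-loop equations as long as `(x̃, ε)` has stayed in `P`. -/
structure IsSolutionWhile (S : System nr no nc nzo nzc)
    (M : EuclideanSpace ℝ (Fin nr) → ℝ → ℝ → State no nc nzo nzc)
    (εstar : EuclideanSpace ℝ (Fin nr) → ℝ → ℝ → ℝ) (a ω δ N : ℝ)
    (ξ₀ : EuclideanSpace ℝ (Fin nr)) (P : Set (State no nc nzo nzc × ℝ))
    (x : ℝ → State no nc nzo nzc) (e : ℝ → ℝ) : Prop where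
  continuousOn_x : ContinuousOn x (Ici (-S.τd ω))
  continuousOn_e : ContinuousOn e (Ici (-S.τd ω))
  hasDeriv_x : ∀ τ : ℝ, 0 ≤ τ → (∀ s ∈ Icc 0 τ, (x s, scanRate (εstar ξ₀ N) a ω e s) ∈ P) →
    HasDerivWithinAt x
      (S.ftilde M (x τ) (S.ξr N ξ₀ τ) (scanRate (εstar ξ₀ N) a ω e τ) N -
        (S.adaptRate M a ω δ N ξ₀ x (scanRate (εstar ξ₀ N) a ω e) τ +
          a * ω * Real.cos (ω * τ)) •
          deriv (fun η => M (S.ξr N ξ₀ τ) η N) (scanRate (εstar ξ₀ N) a ω e τ))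
      (Ici 0) τ
  hasDeriv_e : ∀ τ : ℝ, 0 ≤ τ → (∀ s ∈ Icc 0 τ, (x s, scanRate (εstar ξ₀ N) a ω e s) ∈ P) →
    HasDerivWithinAt e
      (S.adaptRate M a ω δ N ξ₀ x (scanRate (εstar ξ₀ N) a ω e) τ - deriv (εstar ξ₀ N) τ)
      (Ici 0) τ

/-- Averaging: once the state error is below `r` and the scan rate differs by at most `m` from
the dithered estimate `h + a sin(ωσ)`, the adaptation rate follows the gradient of the steady-state
map at `h`. The constant `s₀` bounds the variation of the steady-state map over a dither period. -/
lemma abs_adaptRate_sub_gradient_le (hreg : S.RegularityAssumption εbar Nmin)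
    (hss : S.SteadyStateAssumption M εbar Nmin) {N : ℝ} (hN : Nmin ≤ N)
    {ξ₀ : EuclideanSpace ℝ (Fin nr)} {K C a ω δ τ h r m s₀ B η c : ℝ}
    (hJ : S.OutputBound M N ξ₀ K C) (ha : 0 < a) (hω : 0 < ω) (hδ : 0 < δ)
    {x : ℝ → State no nc nzo nzc} {eps : ℝ → ℝ}
    (hxc : ContinuousOn x (Ici c)) (hec : ContinuousOn eps (Ici c)) (hc : c ≤ τ - S.τd ω)
    (hK : εbar ≤ K) (hr : r ≤ K)
    (hx : ∀ s ∈ Icc (τ - S.τd ω) τ, ‖x s‖ ≤ r ∧ eps s ∈ Icc 0 εbar)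
    (hm : ∀ σ ∈ Icc (τ - 2 * Real.pi / ω) τ, ∀ s ∈ Icc (σ - S.Tl) σ,
      |eps s - (h + a * Real.sin (ω * σ))| ≤ m)
    (hh : a < h) (hh' : h < εbar - a)
    (hslow : ∀ η ∈ Ioo 0 εbar, ∀ σ ∈ Icc (τ - 2 * Real.pi / ω) τ,
      |S.Jbar M ξ₀ η N σ - S.Jbar M ξ₀ η N τ| ≤ s₀)
    (hB : ∀ η ∈ Ioo 0 εbar, DifferentiableAt ℝ (fun η => S.Jbar M ξ₀ η N τ) η ∧
      DifferentiableAt ℝ (deriv fun η => S.Jbar M ξ₀ η N τ) η ∧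
      |deriv (deriv fun η => S.Jbar M ξ₀ η N τ) η| ≤ B)
    (hη : C * (r + m) + s₀ + B * a ^ 2 ≤ η * a) :
    |S.adaptRate M a ω δ N ξ₀ x eps τ -
      a ^ 2 * ω * δ * (deriv (fun η => S.Jbar M ξ₀ η N τ) h * Real.cos (ω * S.τφ))| ≤
      a ^ 2 * ω * δ * (2 * η) := by
  have hP : 0 < 2 * Real.pi / ω := by positivity
  refine abs_average_sub_le (A := S.Jbar M ξ₀ h N τ) ha hω hδ
    ((continuousOn_J hreg hss hN ξ₀ hxc hec).mono fun σ hσ => ?_) fun σ hσ => ?_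
  · have := hσ.1
    unfold τd at hc
    rw [mem_Ici]
    linarith
  · have hsin := abs_le.1 (Real.abs_sin_le_one (ω * σ))
    set k : ℝ := h + a * Real.sin (ω * σ) with hk
    have hkm : k ∈ Ioo 0 εbar := ⟨by nlinarith, by nlinarith⟩
    have hhm : h ∈ Ioo 0 εbar := ⟨by linarith, by linarith⟩
    have hsub : Icc (σ - S.Tl) σ ⊆ Icc (τ - S.τd ω) τ :=
      Icc_subset_Icc (by unfold τd; linarith [hσ.1]) hσ.2
    have hsubc : Icc (σ - S.Tl) σ ⊆ Ici c := fun s hs => hc.trans (hsub hs).1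
    have hσm : σ ∈ Icc (σ - S.Tl) σ := ⟨by linarith [S.Tl_pos], le_rfl⟩
    have hr0 : 0 ≤ r := (norm_nonneg _).trans (hx σ (hsub hσm)).1
    have hm0 : 0 ≤ m := (abs_nonneg _).trans (hm σ hσ σ hσm)
    have hK0 : 0 ≤ K := hr0.trans hr
    have h1 := (hJ σ x eps (hxc.mono hsubc) (hec.mono hsubc) fun s hs =>
      ⟨(hx s (hsub hs)).1.trans hr, abs_le.2 ⟨by linarith [(hx s (hsub hs)).2.1],
        (hx s (hsub hs)).2.2.trans hK⟩⟩).2 (fun _ => 0) (fun _ => k) continuousOn_const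
      continuousOn_const (fun s _ => ⟨by simpa using hK0, abs_le.2 ⟨by linarith [hkm.1],
        hkm.2.le.trans hK⟩⟩) (r + m) fun s hs => ⟨by
          rw [sub_zero]; linarith [(hx s (hsub hs)).1], by linarith [hm σ hσ s hs]⟩
    rw [J_zero_const] at h1
    have h2 := hslow k hkm σ hσ
    have h3 := abs_sub_sub_deriv_mul_le hB hhm hkm
    have h4 : k - h = a * Real.sin (ω * σ) := by rw [hk]; ring
    have hB0 : 0 ≤ B := (abs_nonneg _).trans (hB h hhm).2.2
    rw [h4] at h3
    have h5 : B * (a * Real.sin (ω * σ)) ^ 2 ≤ B * a ^ 2 := by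
      refine mul_le_mul_of_nonneg_left ?_ hB0
      rw [mul_pow]
      nlinarith [Real.sin_sq_le_one (ω * σ), sq_nonneg a]
    have h6 : S.J M N ξ₀ x eps σ - (S.Jbar M ξ₀ h N τ +
        deriv (fun η => S.Jbar M ξ₀ η N τ) h * (a * Real.sin (ω * σ))) =
        (S.J M N ξ₀ x eps σ - S.Jbar M ξ₀ k N σ) + (S.Jbar M ξ₀ k N σ - S.Jbar M ξ₀ k N τ) +
        (S.Jbar M ξ₀ k N τ - (S.Jbar M ξ₀ h N τ +
          deriv (fun η => S.Jbar M ξ₀ η N τ) h * (a * Real.sin (ω * σ)))) := by ring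
    rw [h6]
    refine (abs_add_three _ _ _).trans ?_
    linarith

end System

lemma exists_forall_Ioo_of_eventually {p : ℝ → Prop} (h : ∀ᶠ z in 𝓝[>] (0 : ℝ), p z) :
    ∃ m, 0 < m ∧ ∀ z ∈ Ioo 0 m, p z := by
  obtain ⟨m, hm, hsub⟩ := mem_nhdsGT_iff_exists_Ioo_subset.1 h
  exact ⟨m, hm, fun z hz => hsub hz⟩

lemma eventually_mul_le (c : ℝ) {d : ℝ} (hd : 0 < d) : ∀ᶠ z in 𝓝[>] (0 : ℝ), c * z ≤ d := by
  have h : Tendsto (fun z : ℝ => c * z) (𝓝 0) (𝓝 (c * 0)) := (continuous_const_mul c).tendsto 0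
  rw [mul_zero] at h
  exact (h.mono_left nhdsWithin_le_nhds).eventually (eventually_le_nhds hd)

lemma eventually_div_le (c : ℝ) {d : ℝ} (hd : 0 < d) : ∀ᶠ N in atTop, c / N ≤ d :=
  (tendsto_const_nhds.div_atTop tendsto_id).eventually (eventually_le_nhds hd)

lemma ClassK.pos {α : ℝ → ℝ} (h : ClassK α) {s : ℝ} (hs : 0 < s) : 0 < α s := by
  have := h.strictMonoOn self_mem_Ici hs.le hs
  rwa [h.map_zero] at this

lemma ClassK.exists_lt {α : ℝ → ℝ} (h : ClassK α) {R d : ℝ} (hR : 0 < R) (hd : 0 < d) :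
    ∃ s, 0 < s ∧ s ≤ R ∧ α s ≤ d := by
  have h1 : Tendsto α (𝓝[>] 0) (𝓝 (α 0)) :=
    (h.continuousOn 0 self_mem_Ici).mono_left (nhdsWithin_mono _ Ioi_subset_Ici_self)
  rw [h.map_zero] at h1
  obtain ⟨s, hs⟩ := ((h1.eventually (eventually_le_nhds hd)).and
    (Ioc_mem_nhdsGT hR)).exists
  exact ⟨s, hs.2.1, hs.2.2, hs.1⟩

lemma half_le_cos {x : ℝ} (h0 : 0 ≤ x) (h1 : x ≤ 1) : 1 / 2 ≤ Real.cos x := by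
  have := Real.one_sub_sq_div_two_le_cos (x := x)
  nlinarith

lemma mul_le_neg_half {J' g c : ℝ} (hg : 0 < g) (hJ : J' ≤ -g) (hc : 1 / 2 ≤ c) :
    J' * c ≤ -(g / 2) := by
  nlinarith

namespace System

variable {nr no nc nzo nzc : ℕ} {S : System nr no nc nzo nzc}
  {M : EuclideanSpace ℝ (Fin nr) → ℝ → ℝ → State no nc nzo nzc}
  {εstar : EuclideanSpace ℝ (Fin nr) → ℝ → ℝ → ℝ} {εbar Nmin : ℝ}

/-- The gradient condition bounds the slope away from zero outside a neighbourhood of the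
maximiser. -/
lemma slope_of_gradient {αJ : ℝ → ℝ} (hαJ : ClassK αJ) {J' e b εbar : ℝ} (hb : 0 < b)
    (hε : 0 < εbar) (he : |e| ≤ εbar) (hg : J' * e ≤ -αJ |e|) :
    (b ≤ e → J' ≤ -(αJ b / εbar)) ∧ (e ≤ -b → αJ b / εbar ≤ J') := by
  have hαb := hαJ.pos hb
  have mono : b ≤ |e| → αJ b ≤ αJ |e| := fun h =>
    hαJ.strictMonoOn.monotoneOn hb.le (hb.le.trans h) h
  constructor
  · intro hbe
    have h1 := mono (hbe.trans (le_abs_self e))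
    have h2 : e ≤ εbar := (le_abs_self e).trans he
    have h3 : αJ b ≤ (-J') * e := by linarith
    have h4 : 0 ≤ -J' := by
      by_contra hcon
      push Not at hcon
      nlinarith
    rw [le_neg, div_le_iff₀ hε]
    nlinarith
  · intro hbe
    have h1 := mono ((le_neg.1 hbe).trans (neg_le_abs e))
    have h2 : -e ≤ εbar := (neg_le_abs e).trans he
    have h3 : αJ b ≤ J' * (-e) := by linarith
    have h4 : 0 ≤ J' := by
      by_contra hcon
      push Not at hcon
      nlinarith
    rw [div_le_iff₀ hε]
    nlinarith

set_option maxHeartbeats 1000000 in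
/-- A priori bounds. For a suitable region, and parameters chosen in the order `a`, `ω`, `δ`, `N`,
every pair `(x, e)` with an admissible history that obeys the closed loop inside the region stays
in the region, and enters the prescribed neighbourhoods of the origin. Since the equations are only
assumed inside the region, this applies both to solutions of the closed loop and to solutions of
the truncated equations that serve to construct them. -/
theorem eventually_trapped
    (hεbar : 0 < εbar) (hNmin : 0 < Nmin)
    (href : S.ReferenceAssumption Nmin)
    (hreg : S.RegularityAssumption εbar Nmin)
    (hss : S.SteadyStateAssumption M εbar Nmin)
    (hmax : S.MaximumAssumption M εstar εbar Nmin)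
    (hslow : S.SlowlyVaryingAssumption M εstar εbar Nmin)
    {ρx₀ ρε₀ νpos νx νε : ℝ} (hρx₀ : 0 < ρx₀) (hρε₀ : 0 < ρε₀) (hνpos : 0 < νpos)
    (hνx : 0 < νx) (hνε : 0 < νε) :
    ∃ ρ κ : ℝ, ρx₀ ≤ ρ ∧ 0 < κ ∧ κ ≤ εbar - κ ∧
    ∃ aMax : ℝ, 0 < aMax ∧ ∀ a ∈ Ioo 0 aMax,
    ∃ ωMax : ℝ, 0 < ωMax ∧ ∀ ω ∈ Ioo 0 ωMax,
    ∃ δMax : ℝ, 0 < δMax ∧ ∀ δ ∈ Ioo 0 δMax,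
    ∃ NLow : ℝ, Nmin < NLow ∧ ∀ N : ℝ, NLow < N → ∀ ξ₀ ∈ S.Dr, ∀ x e,
      S.IsSolutionWhile M εstar a ω δ N ξ₀
        {z | ‖z.1‖ ≤ ρ ∧ z.2 ∈ Icc κ (εbar - κ)} x e →
      S.IsInitialHistory (εstar ξ₀ N) εbar ω ρx₀ ρε₀ νpos x e →
      (∀ τ, 0 ≤ τ → ‖x τ‖ ≤ ρ ∧ |e τ| ≤ εbar ∧
        scanRate (εstar ξ₀ N) a ω e τ ∈ Icc κ (εbar - κ)) ∧
      (∀ᶠ τ in atTop, ‖x τ‖ ≤ νx) ∧ ∀ᶠ τ in atTop, |e τ| ≤ νε := by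
  obtain ⟨R, hR⟩ := href.bounded
  obtain ⟨α₁, α₂, αf, V, hα₁, hα₂, hαf, hVsm, hVb, hVl⟩ := hss.lyapunov
  obtain ⟨B, hB⟩ := hmax.deriv_bounded
  obtain ⟨αJ, hαJ, hgrad⟩ := hmax.gradient
  obtain ⟨lo, hi, hlo, hhi, hint⟩ := hmax.interior
  obtain ⟨kJ, hkJ, hJslow⟩ := hslow.Jbar_slow
  obtain ⟨kε, hkε, hεslow⟩ := hslow.εstar_slow
  -- the margin `κ`: histories start, and the maximiser lies, in `[4κ, εbar - 4κ]`
  obtain ⟨κ, hκ, hκ1, hκ2, hκ3⟩ : ∃ κ, 0 < κ ∧ 4 * κ ≤ νpos ∧ 4 * κ ≤ lo ∧ 4 * κ ≤ εbar - hi := by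
    have h : 0 < min νpos (min lo (εbar - hi)) :=
      lt_min hνpos (lt_min hlo.1 (sub_pos.2 hhi.2))
    refine ⟨min νpos (min lo (εbar - hi)) / 4, by positivity, ?_, ?_, ?_⟩ <;>
      rw [mul_div_cancel₀ _ (by norm_num)]
    · exact min_le_left _ _
    · exact (min_le_right _ _).trans (min_le_left _ _)
    · exact (min_le_right _ _).trans (min_le_right _ _)
  obtain ⟨ρ, hρ1, hρ2⟩ : ∃ ρ, ρx₀ + 1 ≤ ρ ∧ α₂ ρx₀ < α₁ ρ :=
    ((eventually_ge_atTop _).and (hα₁.tendsto_atTop.eventually_gt_atTop _)).exists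
  have hρ0 : 0 < ρ := by linarith
  set K : ℝ := max ρ (ρε₀ + εbar + 1) with hK
  have hKρ : ρ ≤ K := le_max_left _ _
  have hKε : ρε₀ + εbar + 1 ≤ K := le_max_right _ _
  obtain ⟨C, hC, hJ⟩ := exists_outputBound href hreg hss K
  obtain ⟨CM, hCM⟩ := hss.locally_bounded (max R K)
  obtain ⟨CV, hCV⟩ := hVb ρ κ hκ
  set b : ℝ := min νε κ with hb
  have hb0 : 0 < b := lt_min hνε hκ
  set g : ℝ := αJ b / εbar with hg
  have hg0 : 0 < g := div_pos (hαJ.pos hb0) hεbar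
  refine ⟨ρ, κ, by linarith, hκ, by linarith [hlo.2], ?_⟩
  -- `g` is the least slope of the steady-state map outside the `b`-neighbourhood of the maximiser.
  -- The gradient estimate has an error of at most `g / 8`, shared by five sources, each of which
  -- takes at most `g / 40`: curvature (controlled by `a`), the residual state error (by `r`), the
  -- delays (by `ω`), the drift of `ε̂` over a period (by `δ`), and the drift of the map (by `N`).
  obtain ⟨aMax, haMax, ha⟩ := exists_forall_Ioo_of_eventually
    ((eventually_mul_le 1 hκ).and ((eventually_mul_le 1 one_pos).and
      (eventually_mul_le (max B 0) (show 0 < g / 40 by positivity))))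
  refine ⟨aMax, haMax, fun a haa => ?_⟩
  obtain ⟨ha1, ha2, ha3⟩ := ha a haa
  rw [one_mul] at ha1 ha2
  have ha0 : 0 < a := haa.1
  -- the level `r` below which the state error does not disturb the gradient estimate
  set r : ℝ := min (min νx ρ) (a * g / (40 * C)) with hr
  have hr0 : 0 < r := lt_min (lt_min hνx hρ0) (by positivity)
  have hrC : C * r ≤ a * g / 40 := by
    have : r ≤ a * g / (40 * C) := min_le_right _ _
    calc C * r ≤ C * (a * g / (40 * C)) := by gcongr
      _ = a * g / 40 := by field_simp
  obtain ⟨r', hr'0, hr'1, hr'2⟩ := hα₂.toClassK.exists_lt hρx₀ (hα₁.toClassK.pos hr0)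
  -- half of the decay rate `αf r'` is left to absorb the drift of the equilibrium
  set q : ℝ := αf r' / 2 with hq
  have hq0 : 0 < q := half_pos (hαf.pos hr'0)
  set Tx : ℝ := α₂ ρx₀ / q with hTx
  have hTx0 : 0 ≤ Tx := (div_pos (hα₂.toClassK.pos hρx₀) hq0).le
  obtain ⟨ωMax, hωMax, hω⟩ := exists_forall_Ioo_of_eventually
    ((eventually_mul_le (max CV 0 * (2 * a * (max CM 0 + 1))) hq0).and
      ((eventually_mul_le S.Tl one_pos).and
      (eventually_mul_le (C * (2 * S.Tl)) (show 0 < g / 40 by positivity))))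
  refine ⟨ωMax, hωMax, fun ω hωω => ?_⟩
  obtain ⟨hω1, hω2, hω3⟩ := hω ω hωω
  have hω0 : 0 < ω := hωω.1
  have hP : 0 < 2 * Real.pi / ω := by have := Real.pi_pos; positivity
  have hτd : 0 < S.τd ω := add_pos S.Tl_pos hP
  obtain ⟨δMax, hδMax, hδ⟩ := exists_forall_Ioo_of_eventually
    ((eventually_mul_le (2 * C) one_pos).and
      ((eventually_mul_le (2 * a * ω * C * (Tx + S.τd ω)) hκ).and
      (eventually_mul_le (C * (4 * Real.pi * C)) (show 0 < g / 40 by positivity))))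
  refine ⟨δMax, hδMax, fun δ hδδ => ?_⟩
  obtain ⟨hδ1, hδ2, hδ3⟩ := hδ δ hδδ
  have hδ0 : 0 < δ := hδδ.1
  have hα0 : 0 < a ^ 2 * ω * δ := by positivity
  obtain ⟨NLow, hNLow⟩ := eventually_atTop.1 ((eventually_div_le (kJ * (2 * Real.pi / ω))
    (show 0 < a * g / 40 by positivity)).and (eventually_div_le kε
      (show 0 < a ^ 2 * ω * δ * (g / 8) by positivity)))
  refine ⟨max NLow (Nmin + 1), by
    have := le_max_right NLow (Nmin + 1); linarith, fun N hN ξ₀ hξ₀ x e hsol hini => ?_⟩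
  obtain ⟨hN1, hN2⟩ := hNLow N ((le_max_left _ _).trans hN.le)
  have hNm' : Nmin < N := by have := le_max_right NLow (Nmin + 1); linarith
  have hNm : Nmin ≤ N := hNm'.le
  have hN0 : 0 < N := hNmin.trans hNm'
  set εs : ℝ → ℝ := εstar ξ₀ N with hεs
  set eps : ℝ → ℝ := scanRate εs a ω e with heps
  set hh : ℝ → ℝ := fun τ => e τ + εs τ with hhh
  set E : ℝ → ℝ := S.adaptRate M a ω δ N ξ₀ x eps with hE
  have hεsd : ∀ τ, HasDerivAt εs (deriv εs τ) τ := fun τ =>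
    ((hslow.εstar_smooth N hNm ξ₀ hξ₀).differentiable (by norm_num) τ).hasDerivAt
  have hεsc : Continuous εs := (hslow.εstar_smooth N hNm ξ₀ hξ₀).continuous
  have hεsm : ∀ τ, εs τ ∈ Icc (4 * κ) (εbar - 4 * κ) := fun τ => by
    have := hint N hNm' ξ₀ hξ₀ τ
    exact ⟨by linarith [this.1], by linarith [this.2]⟩
  have hepsc : ContinuousOn eps (Ici (-S.τd ω)) := by
    have := hsol.continuousOn_e
    change ContinuousOn (fun τ => e τ + εs τ + a * Real.sin (ω * τ)) _
    fun_prop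
  have heh : ∀ τ, eps τ = hh τ + a * Real.sin (ω * τ) := fun τ => rfl
  have hsin : ∀ τ, |a * Real.sin (ω * τ)| ≤ a := fun τ => by
    rw [abs_mul, abs_of_pos ha0]
    exact mul_le_of_le_one_right ha0.le (Real.abs_sin_le_one _)
  -- the region in terms of `ε̂` lies in the region in terms of `ε`
  have hepsr : ∀ s, hh s ∈ Icc (2 * κ) (εbar - 2 * κ) → eps s ∈ Icc κ (εbar - κ) := fun s hs => by
    have := abs_le.1 (hsin s)
    rw [heh]
    exact ⟨by linarith [hs.1, this.1], by linarith [hs.2, this.2]⟩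
  have hhist : ∀ s ∈ Icc (-S.τd ω) 0, ‖x s‖ ≤ K ∧ |eps s| ≤ K := fun s hs => by
    have h1 := hini.norm_x_le s hs
    have h2 := hini.abs_e_le s hs
    have h3 := hεsm s
    have h4 : |εs s| ≤ εbar := abs_le.2 ⟨by linarith [h3.1], by linarith [h3.2]⟩
    refine ⟨by linarith, ?_⟩
    rw [heh]
    refine (abs_add_le _ _).trans ?_
    have h5 := abs_add_le (e s) (εs s)
    have h6 := hsin s
    simp only [hhh]
    linarith
  have hregK : ∀ s, ‖x s‖ ≤ ρ ∧ hh s ∈ Icc (2 * κ) (εbar - 2 * κ) → ‖x s‖ ≤ K ∧ |eps s| ≤ K :=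
    fun s hs => by
      have := hepsr s hs.2
      exact ⟨hs.1.trans hKρ, abs_le.2 ⟨by linarith [this.1], by linarith [this.2]⟩⟩
  -- the adaptation is bounded although the window reaches back into the initial history
  have hEb : ∀ τ, 0 ≤ τ → (∀ s ∈ Icc 0 τ, ‖x s‖ ≤ ρ ∧ hh s ∈ Icc (2 * κ) (εbar - 2 * κ)) →
      |E τ| ≤ 2 * a * ω * δ * C := fun τ hτ hin => by
    refine abs_adaptRate_le ha0 hω0 hδ0 fun σ hσ => ?_
    have hsub : Icc (σ - S.Tl) σ ⊆ Ici (-S.τd ω) := fun s hs => by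
      rw [mem_Ici]; unfold τd; linarith [hs.1, hσ.1]
    refine (hJ N hNm ξ₀ hξ₀ σ x eps (hsol.continuousOn_x.mono hsub) (hepsc.mono hsub)
      fun s hs => ?_).1
    rcases le_total s 0 with hs0 | hs0
    · exact hhist s ⟨hsub hs, hs0⟩
    · exact hregK s (hin s ⟨hs0, hs.2.trans hσ.2⟩)
  have hvb : ∀ τ, |E τ| ≤ 2 * a * ω * δ * C → |E τ + a * ω * Real.cos (ω * τ)| ≤ 2 * a * ω :=
    fun τ hEτ => by
      have h1 : |a * ω * Real.cos (ω * τ)| ≤ a * ω := by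
        rw [abs_mul, abs_of_pos (by positivity)]
        exact mul_le_of_le_one_right (by positivity) (Real.abs_cos_le_one _)
      have h2 : 2 * a * ω * δ * C ≤ a * ω := by
        calc 2 * a * ω * δ * C = a * ω * (2 * C * δ) := by ring
          _ ≤ a * ω * 1 := by gcongr
          _ = a * ω := mul_one _
      exact (abs_add_le _ _).trans (by linarith)
  have hP' : ∀ τ, (∀ s ∈ Icc 0 τ, ‖x s‖ ≤ ρ ∧ hh s ∈ Icc (2 * κ) (εbar - 2 * κ)) →
      ∀ s ∈ Icc 0 τ, (x s, eps s) ∈ {z : State no nc nzo nzc × ℝ |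
        ‖z.1‖ ≤ ρ ∧ z.2 ∈ Icc κ (εbar - κ)} :=
    fun τ hin s hs => ⟨(hin s hs).1, hepsr s (hin s hs).2⟩
  have hde : ∀ τ, 0 ≤ τ → (∀ s ∈ Icc 0 τ, ‖x s‖ ≤ ρ ∧ hh s ∈ Icc (2 * κ) (εbar - 2 * κ)) →
      HasDerivWithinAt e (E τ - deriv εs τ) (Ici 0) τ :=
    fun τ hτ hin => hsol.hasDeriv_e τ hτ (hP' τ hin)
  have hdh : ∀ τ, 0 ≤ τ → (∀ s ∈ Icc 0 τ, ‖x s‖ ≤ ρ ∧ hh s ∈ Icc (2 * κ) (εbar - 2 * κ)) →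
      HasDerivWithinAt hh (E τ) (Ici 0) τ := fun τ hτ hin => by
    have := (hde τ hτ hin).add (hεsd τ).hasDerivWithinAt
    rwa [sub_add_cancel] at this
  have hdeps : ∀ τ, 0 ≤ τ → (∀ s ∈ Icc 0 τ, ‖x s‖ ≤ ρ ∧ hh s ∈ Icc (2 * κ) (εbar - 2 * κ)) →
      HasDerivWithinAt eps (E τ + a * ω * Real.cos (ω * τ)) (Ici 0) τ := fun τ hτ hin => by
    have h1 : HasDerivAt (fun τ => a * Real.sin (ω * τ)) (a * ω * Real.cos (ω * τ)) τ := by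
      have := (((hasDerivAt_id τ).const_mul ω).sin).const_mul a
      refine this.congr_deriv ?_
      simp only [id, mul_one]; ring
    exact (hdh τ hτ hin).add h1.hasDerivWithinAt
  -- the Lyapunov function along the solution
  set U : State no nc nzo nzc × ℝ → ℝ := fun z => V z.1 z.2 N with hU
  set W : ℝ → ℝ := fun s => U (x s, eps s) with hW
  set w : ℝ → ℝ := fun τ => fderiv ℝ U (x τ, eps τ)
    (S.ftilde M (x τ) (S.ξr N ξ₀ τ) (eps τ) N - (E τ + a * ω * Real.cos (ω * τ)) •
      deriv (fun η => M (S.ξr N ξ₀ τ) η N) (eps τ), E τ + a * ω * Real.cos (ω * τ)) with hw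
  have hdW : ∀ τ, 0 ≤ τ → (∀ s ∈ Icc 0 τ, ‖x s‖ ≤ ρ ∧ hh s ∈ Icc (2 * κ) (εbar - 2 * κ)) →
      HasDerivWithinAt W (w τ) (Ici 0) τ ∧ (α₂ r' ≤ W τ → w τ ≤ -q) ∧
      (W τ ≤ α₂ r' → ‖x τ‖ ≤ r) ∧ (W τ ≤ α₂ ρx₀ → ‖x τ‖ < ρ) := fun τ hτ hin => by
    have hin' := hin τ ⟨hτ, le_rfl⟩
    have hετ := hepsr τ hin'.2
    have hετ' : eps τ ∈ Ioo 0 εbar := ⟨by linarith [hετ.1], by linarith [hετ.2]⟩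
    obtain ⟨hV1, hV2, hV3⟩ := hVl (eps τ) ⟨hετ'.1, hετ'.2.le⟩ N hNm ξ₀ hξ₀ (x τ)
    have hUd : DifferentiableAt ℝ U (x τ, eps τ) :=
      ((hVsm N hNm).differentiableOn (by norm_num)).differentiableAt
        (prod_mem_nhds univ_mem (Ioc_mem_nhds hετ'.1 hετ'.2))
    have hCVτ := hCV N hNm (x τ) hin'.1 (eps τ) ⟨hετ.1, hετ'.2⟩
    obtain ⟨h1, h2⟩ := hasDerivWithinAt_lyapunov (C := max CV 0) hUd
      (hsol.hasDeriv_x τ hτ (hP' τ hin)) (hdeps τ hτ hin) (hCVτ.trans (le_max_left _ _))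
    refine ⟨h1, fun hWτ => ?_, fun hWτ => ?_, fun hWτ => ?_⟩
    · have hx1 : r' ≤ ‖x τ‖ := (hα₂.strictMonoOn.le_iff_le hr'0.le (norm_nonneg _)).1
        (hWτ.trans hV2)
      have hx2 : αf r' ≤ αf ‖x τ‖ := hαf.strictMonoOn.monotoneOn hr'0.le (norm_nonneg _) hx1
      have hm := (hCM N hNm (S.ξr N ξ₀ τ) ((hR N hNm ξ₀ hξ₀ τ).trans (le_max_left _ _)) (eps τ)
        ((hregK τ hin').2.trans (le_max_right _ _))).2
      have hv := hvb τ (hEb τ hτ hin)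
      have h3 : max CV 0 * (|E τ + a * ω * Real.cos (ω * τ)| *
          (‖deriv (fun η => M (S.ξr N ξ₀ τ) η N) (eps τ)‖ + 1)) ≤ q := by
        refine le_trans (mul_le_mul_of_nonneg_left (mul_le_mul hv
          (add_le_add (hm.trans (le_max_left CM 0)) le_rfl) (by positivity) (by positivity))
          (le_max_right _ _)) (le_trans (le_of_eq (by ring)) hω1)
      have h4 := hV3 τ hτ
      have h5 : αf r' = 2 * q := by rw [hq]; ring
      refine h2.trans ?_
      change fderiv ℝ (fun y => V y (eps τ) N) (x τ) _ + _ ≤ _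
      linarith
    · by_contra hcon
      push Not at hcon
      have := hα₁.strictMonoOn hr0.le (norm_nonneg _) hcon
      have h6 : W τ = V (x τ) (eps τ) N := rfl
      linarith
    · by_contra hcon
      push Not at hcon
      have := hα₁.strictMonoOn.monotoneOn hρ0.le (norm_nonneg _) hcon
      have h6 : W τ = V (x τ) (eps τ) N := rfl
      linarith
  have h0mem : (0 : ℝ) ∈ Icc (-S.τd ω) 0 := ⟨by linarith, le_rfl⟩
  have hh0 : hh 0 ∈ Icc (4 * κ) (εbar - 4 * κ) := by
    have := hini.start
    exact ⟨by linarith [this.1], by linarith [this.2]⟩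
  have hsub0 : Ici (0 : ℝ) ⊆ Ici (-S.τd ω) := Ici_subset_Ici.2 h0mem.1
  have hcos : 1 / 2 ≤ Real.cos (ω * S.τφ) := by
    refine half_le_cos (mul_nonneg hω0.le S.τφ_mem.1) ?_
    rw [mul_comm]
    exact (mul_le_mul_of_nonneg_right S.τφ_mem.2 hω0.le).trans hω2
  -- outside the `b`-neighbourhood of the maximiser the estimate `ε̂` moves towards it
  have hgradE : ∀ τ, Tx + S.τd ω ≤ τ →
      (∀ s ∈ Icc 0 τ, ‖x s‖ ≤ ρ ∧ hh s ∈ Icc (2 * κ) (εbar - 2 * κ)) →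
      (∀ s ∈ Icc (τ - S.τd ω) τ, ‖x s‖ ≤ r) →
      (b ≤ e τ → E τ ≤ -(a ^ 2 * ω * δ * (g / 8)) ∧
        E τ - deriv εs τ ≤ -(a ^ 2 * ω * δ * (g / 8))) ∧
      (e τ ≤ -b → a ^ 2 * ω * δ * (g / 8) ≤ E τ ∧
        a ^ 2 * ω * δ * (g / 8) ≤ E τ - deriv εs τ) := fun τ hτ hin hxr => by
    have hτ0 : 0 ≤ τ := by linarith
    have hin' : ∀ t ∈ Icc 0 τ, ∀ s ∈ Icc 0 t, ‖x s‖ ≤ ρ ∧ hh s ∈ Icc (2 * κ) (εbar - 2 * κ) :=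
      fun t ht s hs => hin s ⟨hs.1, hs.2.trans ht.2⟩
    have hhτ := (hin τ ⟨hτ0, le_rfl⟩).2
    have hhτ' : hh τ ∈ Ioo 0 εbar := ⟨by linarith [hhτ.1], by linarith [hhτ.2]⟩
    have htd : S.τd ω = S.Tl + 2 * Real.pi / ω := rfl
    have hest := abs_adaptRate_sub_gradient_le hreg hss hNm (hJ N hNm ξ₀ hξ₀) ha0 hω0 hδ0
      (x := x) (eps := eps) (τ := τ) (h := hh τ) (r := r)
      (m := 2 * a * ω * S.Tl + 2 * a * ω * δ * C * (2 * Real.pi / ω))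
      (s₀ := kJ / N * (2 * Real.pi / ω)) (B := max B 0) (η := g / 8)
      hsol.continuousOn_x hepsc (by linarith) (by linarith)
      (le_trans ((min_le_left _ _).trans (min_le_right _ _)) hKρ)
      (fun s hs => ⟨hxr s hs, by
        have := hepsr s (hin s ⟨by linarith [hs.1], hs.2⟩).2
        exact ⟨by linarith [this.1], by linarith [this.2]⟩⟩)
      (fun σ hσ s hs => by
        have hs0 : 0 ≤ s := by linarith [hs.1, hσ.1]
        have h1 := abs_sub_le_of_hasDerivWithinAt_Ici (f := eps) hs0 hs.2 fun u hu =>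
          have hu' : u ∈ Icc 0 τ := ⟨hs0.trans hu.1, hu.2.trans hσ.2⟩
          ⟨hdeps u hu'.1 (hin' u hu'), hvb u (hEb u hu'.1 (hin' u hu'))⟩
        have h2 := abs_sub_le_of_hasDerivWithinAt_Ici (f := hh) (hs0.trans hs.2) hσ.2 fun u hu =>
          have hu' : u ∈ Icc 0 τ := ⟨(hs0.trans hs.2).trans hu.1, hu.2⟩
          ⟨hdh u hu'.1 (hin' u hu'), hEb u hu'.1 (hin' u hu')⟩
        have h3 : 2 * a * ω * (σ - s) ≤ 2 * a * ω * S.Tl := by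
          gcongr; linarith [hs.1]
        have h4 : 2 * a * ω * δ * C * (τ - σ) ≤ 2 * a * ω * δ * C * (2 * Real.pi / ω) := by
          gcongr; linarith [hσ.1]
        have h5 : eps s - (hh τ + a * Real.sin (ω * σ)) = -(eps σ - eps s) - (hh τ - hh σ) := by
          rw [heh σ]; ring
        rw [h5]
        refine (abs_sub _ _).trans ?_
        rw [abs_neg]
        linarith)
      (by linarith [hhτ.1]) (by linarith [hhτ.2])
      (fun η hη σ hσ => by
        have hη' : η ∈ Ioc 0 εbar := ⟨hη.1, hη.2.le⟩
        have hJd := (hslow.Jbar_smooth η hη' N hNm ξ₀ hξ₀).differentiable (by norm_num)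
        have h1 := (convex_univ (𝕜 := ℝ)).norm_image_sub_le_of_norm_deriv_le
          (f := fun τ => S.Jbar M ξ₀ η N τ) (fun z _ => hJd z)
          (fun z _ => hJslow η hη' N hNm ξ₀ hξ₀ z) (mem_univ τ) (mem_univ σ)
        refine h1.trans (mul_le_mul_of_nonneg_left ?_ (by positivity))
        rw [Real.norm_eq_abs, abs_le]
        exact ⟨by linarith [hσ.1], by linarith [hσ.2]⟩)
      (fun η hη => by
        have := hB η hη N hNm ξ₀ hξ₀ τ
        exact ⟨this.1, this.2.1, this.2.2.2.trans (le_max_left _ _)⟩)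
      (by
        have h1 : C * (2 * a * ω * S.Tl) ≤ a * g / 40 := by
          have := mul_le_mul_of_nonneg_left hω3 ha0.le
          linarith
        have h2 : C * (2 * a * ω * δ * C * (2 * Real.pi / ω)) ≤ a * g / 40 := by
          have := mul_le_mul_of_nonneg_left hδ3 ha0.le
          have h3 : C * (2 * a * ω * δ * C * (2 * Real.pi / ω)) =
              a * (C * (4 * Real.pi * C) * δ) := by field_simp; ring
          linarith
        have h3 : kJ / N * (2 * Real.pi / ω) ≤ a * g / 40 := by
          rw [div_mul_eq_mul_div]; exact hN1
        have h4 : max B 0 * a ^ 2 ≤ a * g / 40 := by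
          have := mul_le_mul_of_nonneg_left ha3 ha0.le
          linarith
        linarith)
    have hslope := slope_of_gradient hαJ hb0 hεbar (e := e τ)
      (J' := deriv (fun η => S.Jbar M ξ₀ η N τ) (hh τ)) (by
        have h1 := hεsm τ
        have h2 : e τ = hh τ - εs τ := by simp only [hhh]; ring
        rw [h2, abs_le]
        exact ⟨by linarith [h1.2, hhτ'.1], by linarith [h1.1, hhτ'.2]⟩) (by
        have h1 := hgrad (hh τ) hhτ' N hNm ξ₀ hξ₀ τ
        have h2 : hh τ - εstar ξ₀ N τ = e τ := by simp only [hhh, hεs]; ring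
        rwa [h2] at h1)
    set J' : ℝ := deriv (fun η => S.Jbar M ξ₀ η N τ) (hh τ) with hJ'
    have hest' := abs_le.1 hest
    have hdε := abs_le.1 ((hεslow N hNm ξ₀ hξ₀ τ).trans hN2)
    constructor
    · intro hbe
      have h1 := hslope.1 hbe
      have h2 := mul_le_neg_half hg0 h1 hcos
      have h3 := mul_le_mul_of_nonneg_left h2 hα0.le
      constructor <;> linarith [hest'.2, hdε.1, mul_pos hα0 hg0]
    · intro hbe
      have h1 := hslope.2 hbe
      have h2 := mul_le_neg_half hg0 (neg_le_neg h1) hcos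
      rw [neg_mul, neg_le_neg_iff] at h2
      have h3 := mul_le_mul_of_nonneg_left h2 hα0.le
      constructor <;> linarith [hest'.1, hdε.2, mul_pos hα0 hg0]
  obtain ⟨hfin1, hfin2, hfin3⟩ := trapped (x := x) (h := hh) (e := e) (W := W) (w := w) (E := E)
    (D := fun τ => deriv εs τ) (u := εbar) (W₀ := α₂ ρx₀) (Tx := Tx) (d := S.τd ω)
    (Em := 2 * a * ω * δ * C) (b := b) hκ hq0 (show 0 < a ^ 2 * ω * δ * (g / 8) by positivity)
    hTx0 hτd.le (hsol.continuousOn_x.mono hsub0)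
    ((hsol.continuousOn_e.mono hsub0).add hεsc.continuousOn) hdW
    (hα₂.strictMonoOn.monotoneOn hr'0.le hρx₀.le hr'1)
    (by
      have h1 := hepsr 0 ⟨by linarith [hh0.1], by linarith [hh0.2]⟩
      have h2 := (hVl (eps 0) ⟨by linarith [h1.1], by linarith [h1.2]⟩ N hNm ξ₀ hξ₀ (x 0)).2.1
      exact h2.trans (hα₂.strictMonoOn.monotoneOn (norm_nonneg _) hρx₀.le
        (hini.norm_x_le 0 h0mem)))
    (by linarith [hini.norm_x_le 0 h0mem])
    (by
      have h1 : q * Tx = α₂ ρx₀ := by rw [hTx]; field_simp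
      have h2 := hα₂.toClassK.pos hr'0
      linarith)
    (fun τ hτ hin => ⟨hdh τ hτ hin, hde τ hτ hin, hEb τ hτ hin⟩)
    (by linarith) hgradE
    (fun τ _ hτ' => by
      have h1 := hεsm τ
      have h2 : b ≤ κ := min_le_right _ _
      simp only [hhh] at hτ'
      linarith [h1.1])
    (fun τ _ hτ' => by
      have h1 := hεsm τ
      have h2 : b ≤ κ := min_le_right _ _
      simp only [hhh] at hτ'
      linarith [h1.2])
    hh0
  refine ⟨fun τ hτ => ⟨(hfin1 τ hτ).1, ?_, hepsr τ (hfin1 τ hτ).2⟩, ?_, ?_⟩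
  · have h1 := hεsm τ
    have h2 := (hfin1 τ hτ).2
    simp only [hhh] at h2
    exact abs_le.2 ⟨by linarith [h1.2, h2.1], by linarith [h1.1, h2.2]⟩
  · exact hfin2.mono fun τ hτ => hτ.trans ((min_le_left _ _).trans (min_le_left _ _))
  · exact hfin3.mono fun τ hτ => hτ.trans (min_le_left _ _)

end System

/-! ### Existence of solutions -/

lemma abs_clamp_sub_le (l u s t : ℝ) : |max l (min u s) - max l (min u t)| ≤ |s - t| := by
  refine (abs_max_sub_max_le_max _ _ _ _).trans ?_
  rw [sub_self, abs_zero]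
  refine max_le (abs_nonneg _) ((abs_min_sub_min_le_max _ _ _ _).trans ?_)
  rw [sub_self, abs_zero]
  exact max_le (abs_nonneg _) le_rfl

/-- A nonexpansive map onto a bounded set that fixes the ball of radius `K`: the coordinatewise
clamp. -/
lemma exists_retraction {ι : Type*} [Fintype ι] (K : ℝ) :
    ∃ (P : EuclideanSpace ℝ ι → EuclideanSpace ℝ ι) (K' : ℝ), LipschitzWith 1 P ∧
      (∀ x, ‖P x‖ ≤ K') ∧ ∀ x, ‖x‖ ≤ K → P x = x := by
  refine ⟨fun x => WithLp.toLp 2 fun i => max (-K) (min K (x i)),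
    √(∑ _i : ι, |K| ^ 2), ?_, fun x => ?_, fun x hx => ?_⟩
  · refine LipschitzWith.of_dist_le_mul fun x y => ?_
    rw [NNReal.coe_one, one_mul, EuclideanSpace.dist_eq, EuclideanSpace.dist_eq]
    refine Real.sqrt_le_sqrt (Finset.sum_le_sum fun i _ => ?_)
    exact pow_le_pow_left₀ dist_nonneg (abs_clamp_sub_le _ _ _ _) 2
  · rw [EuclideanSpace.norm_eq]
    refine Real.sqrt_le_sqrt (Finset.sum_le_sum fun i _ => ?_)
    refine pow_le_pow_left₀ (norm_nonneg _) ?_ 2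
    rw [Real.norm_eq_abs, abs_le]
    have h1 := le_abs_self K
    have h2 := neg_abs_le K
    exact ⟨(by linarith : -|K| ≤ -K).trans (le_max_left _ _),
      max_le (by linarith) ((min_le_left _ _).trans h1)⟩
  · ext i
    have := abs_le.1 ((PiLp.norm_apply_le x i).trans hx)
    simp only
    rw [min_eq_right this.2, max_eq_right this.1]

lemma continuous_integral_window {g : ℝ → ℝ} (hg : Continuous g) (P : ℝ) :
    Continuous fun τ => ∫ σ in (τ - P)..τ, g σ := by
  have h1 : Continuous fun τ => ∫ σ in (0 : ℝ)..τ, g σ :=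
    intervalIntegral.continuous_primitive (fun _ _ => hg.intervalIntegrable _ _) 0
  have h2 : (fun τ => ∫ σ in (τ - P)..τ, g σ) =
      fun τ => (∫ σ in (0 : ℝ)..τ, g σ) - ∫ σ in (0 : ℝ)..(τ - P), g σ := by
    funext τ
    rw [intervalIntegral.integral_interval_sub_left] <;> exact hg.intervalIntegrable _ _
  rw [h2]
  exact h1.sub (h1.comp (by fun_prop))

lemma norm_smul_sub_smul_le {X : Type*} [NormedAddCommGroup X] [NormedSpace ℝ X]
    {α β A B D₁ D₂ : ℝ} {u v : X} (hαβ : |α - β| ≤ D₁) (hβ : |β| ≤ A) (hu : ‖u‖ ≤ B)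
    (huv : ‖u - v‖ ≤ D₂) : ‖α • u - β • v‖ ≤ D₁ * B + A * D₂ := by
  have h : α • u - β • v = (α - β) • u + β • (u - v) := by
    rw [sub_smul, smul_sub]; abel
  rw [h]
  refine (norm_add_le _ _).trans ?_
  rw [norm_smul, norm_smul, Real.norm_eq_abs, Real.norm_eq_abs]
  exact add_le_add (mul_le_mul hαβ hu (norm_nonneg _) ((abs_nonneg _).trans hαβ))
    (mul_le_mul hβ huv (norm_nonneg _) ((abs_nonneg _).trans hβ))

namespace System

variable {nr no nc nzo nzc : ℕ} {S : System nr no nc nzo nzc}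
  {M : EuclideanSpace ℝ (Fin nr) → ℝ → ℝ → State no nc nzo nzc}
  {εstar : EuclideanSpace ℝ (Fin nr) → ℝ → ℝ → ℝ} {εbar Nmin : ℝ}

lemma continuous_adaptRate (hreg : S.RegularityAssumption εbar Nmin)
    (hss : S.SteadyStateAssumption M εbar Nmin) {N : ℝ} (hN : Nmin ≤ N)
    (ξ₀ : EuclideanSpace ℝ (Fin nr)) {x : ℝ → State no nc nzo nzc} {eps : ℝ → ℝ} {a ω δ : ℝ}
    (hx : Continuous x) (he : Continuous eps) :
    Continuous (S.J M N ξ₀ x eps) ∧ Continuous (S.adaptRate M a ω δ N ξ₀ x eps) := by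
  have hJ : Continuous (S.J M N ξ₀ x eps) := by
    rw [continuous_iff_continuousAt]
    intro τ
    exact (continuousOn_J hreg hss hN ξ₀ (c := τ - S.Tl - 1) hx.continuousOn
      he.continuousOn).continuousAt (Ici_mem_nhds (by linarith))
  refine ⟨hJ, ?_⟩
  unfold adaptRate
  exact continuous_const.mul (continuous_integral_window (by fun_prop) _)

lemma contDiffOn_f (hreg : S.RegularityAssumption εbar Nmin) {N : ℝ} (hN : Nmin ≤ N) :
    ContDiffOn ℝ 1 (fun z : State no nc nzo nzc × EuclideanSpace ℝ (Fin nr) × ℝ =>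
      S.f z.1 z.2.1 z.2.2 N) (univ ×ˢ univ ×ˢ Ioc 0 εbar) := by
  set A : Set (State no nc nzo nzc × EuclideanSpace ℝ (Fin nr) × ℝ) :=
    univ ×ˢ univ ×ˢ Ioc 0 εbar with hA
  have hmaps : MapsTo (fun z : State no nc nzo nzc × EuclideanSpace ℝ (Fin nr) × ℝ => z.2.2) A
      (Ioc 0 εbar) := fun z hz => hz.2.2
  have hsc : ContDiffOn ℝ 1
      (fun z : State no nc nzo nzc × EuclideanSpace ℝ (Fin nr) × ℝ => z.2.2) A :=
    contDiff_snd.snd.contDiffOn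
  have hAc : ∀ i j, ContDiffOn ℝ 1 (fun z : State no nc nzo nzc × EuclideanSpace ℝ (Fin nr) × ℝ =>
      S.Ac z.2.2 N i j) A := fun i j => (hreg.Ac_smooth N hN i j).comp hsc hmaps
  have hBc : ∀ i j, ContDiffOn ℝ 1 (fun z : State no nc nzo nzc × EuclideanSpace ℝ (Fin nr) × ℝ =>
      S.Bc z.2.2 N i j) A := fun i j => (hreg.Bc_smooth N hN i j).comp hsc hmaps
  have hCc : ∀ i j, ContDiffOn ℝ 1 (fun z : State no nc nzo nzc × EuclideanSpace ℝ (Fin nr) × ℝ =>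
      S.Cc z.2.2 N i j) A := fun i j => (hreg.Cc_smooth N hN i j).comp hsc hmaps
  have hx : ∀ i, ContDiffOn ℝ 1 (fun z : State no nc nzo nzc × EuclideanSpace ℝ (Fin nr) × ℝ =>
      z.1 i) A := fun i => by fun_prop
  have hξ : ∀ i, ContDiffOn ℝ 1 (fun z : State no nc nzo nzc × EuclideanSpace ℝ (Fin nr) × ℝ =>
      z.2.1 i) A := fun i => by fun_prop
  have hhz : ContDiffOn ℝ 1 (fun z : State no nc nzo nzc × EuclideanSpace ℝ (Fin nr) × ℝ =>
      S.hz z.1) A :=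
    (((contDiff_hz hreg.fs_smooth).of_le (by norm_num)).comp contDiff_fst).contDiffOn
  unfold f
  refine ContDiffOn.smul (hsc.inv fun z hz => hz.2.2.1.ne') ?_
  rw [contDiffOn_euclidean]
  rintro (i | i | i | i)
  · simp only [field, Sum.elim_inl, Pi.add_apply, Matrix.mulVec, dotProduct]
    exact (ContDiffOn.sum fun j _ => contDiffOn_const.mul (hx (.inl j))).add
      (ContDiffOn.sum fun j _ => contDiffOn_const.mul
        (ContDiffOn.sum fun k _ => (hCc j k).mul (hx (.inr (.inl k)))))
  · simp only [field, h, Sum.elim_inl, Sum.elim_inr, Pi.add_apply, Matrix.mulVec, dotProduct,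
      Pi.sub_apply]
    exact (ContDiffOn.sum fun j _ => (hAc i j).mul (hx (.inr (.inl j)))).add
      (ContDiffOn.sum fun j _ => (hBc i j).mul
        ((ContDiffOn.sum fun k _ => contDiffOn_const.mul (hx (.inl k))).sub
          (ContDiffOn.sum fun k _ => contDiffOn_const.mul (hξ k))))
  · simp only [field, Sum.elim_inl, Sum.elim_inr, Pi.add_apply, Matrix.mulVec, dotProduct,
      Pi.smul_apply, smul_eq_mul]
    exact (ContDiffOn.sum fun j _ => contDiffOn_const.mul (hx (.inr (.inr (.inl j))))).add
      ((ContDiffOn.sum fun j _ => contDiffOn_const.mul (hx (.inr (.inr (.inr j))))).mul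
        contDiffOn_const)
  · simp only [field, Sum.elim_inr, Pi.add_apply, Matrix.mulVec, dotProduct,
      Pi.smul_apply, smul_eq_mul]
    exact (ContDiffOn.sum fun j _ => contDiffOn_const.mul (hx (.inr (.inr (.inr j))))).add
      (hhz.mul contDiffOn_const)

lemma contDiffOn_ftilde (hreg : S.RegularityAssumption εbar Nmin)
    (hss : S.SteadyStateAssumption M εbar Nmin) {N : ℝ} (hN : Nmin ≤ N) :
    ContDiffOn ℝ 1 (fun z : State no nc nzo nzc × EuclideanSpace ℝ (Fin nr) × ℝ =>
      S.ftilde M z.1 z.2.1 z.2.2 N) (univ ×ˢ univ ×ˢ Ioc 0 εbar) := by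
  have hM : ContDiff ℝ 1 (fun z : State no nc nzo nzc × EuclideanSpace ℝ (Fin nr) × ℝ =>
      M z.2.1 z.2.2 N) :=
    ((hss.smooth N hN).of_le (by norm_num)).comp contDiff_snd
  have h1 : ContDiff ℝ 1 (fun z : State no nc nzo nzc × EuclideanSpace ℝ (Fin nr) × ℝ =>
      ((z.1 + M z.2.1 z.2.2 N, z.2.1, z.2.2) :
        State no nc nzo nzc × EuclideanSpace ℝ (Fin nr) × ℝ)) :=
    (contDiff_fst.add hM).prodMk contDiff_snd
  have h2 : ContDiff ℝ 1 (fun z : State no nc nzo nzc × EuclideanSpace ℝ (Fin nr) × ℝ =>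
      ((M z.2.1 z.2.2 N, z.2.1, z.2.2) :
        State no nc nzo nzc × EuclideanSpace ℝ (Fin nr) × ℝ)) :=
    hM.prodMk contDiff_snd
  exact ((contDiffOn_f hreg hN).comp h1.contDiffOn fun z hz => ⟨trivial, trivial, hz.2.2⟩).sub
    ((contDiffOn_f hreg hN).comp h2.contDiffOn fun z hz => ⟨trivial, trivial, hz.2.2⟩)

lemma contDiff_deriv_M (hss : S.SteadyStateAssumption M εbar Nmin) {N : ℝ} (hN : Nmin ≤ N) :
    ContDiff ℝ 1 (fun z : EuclideanSpace ℝ (Fin nr) × ℝ => deriv (fun η => M z.1 η N) z.2) := by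
  have h : (fun z : EuclideanSpace ℝ (Fin nr) × ℝ => deriv (fun η => M z.1 η N) z.2) =
      fun z => fderiv ℝ (fun z : EuclideanSpace ℝ (Fin nr) × ℝ => M z.1 z.2 N) z (0, 1) := by
    funext z
    have h1 := ((hss.smooth N hN).differentiable (by norm_num) (z.1, z.2)).hasFDerivAt
    have h2 : HasDerivAt (fun η : ℝ => (z.1, η)) ((0, 1) : EuclideanSpace ℝ (Fin nr) × ℝ) z.2 :=
      (hasDerivAt_const _ _).prodMk (hasDerivAt_id _)
    exact (h1.comp_hasDerivAt z.2 h2).deriv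
  rw [h]
  exact ((hss.smooth N hN).fderiv_right (m := 1) (by norm_num)).clm_apply contDiff_const

/-- Every bounded history extends to a solution of the closed loop up to the exit from the
region. The solution solves the equations with the arguments clamped to bounded sets, where the
right-hand side is bounded and Lipschitz. -/
theorem exists_isSolutionWhile (href : S.ReferenceAssumption Nmin)
    (hreg : S.RegularityAssumption εbar Nmin)
    (hss : S.SteadyStateAssumption M εbar Nmin)
    (hmax : S.MaximumAssumption M εstar εbar Nmin)
    (hslow : S.SlowlyVaryingAssumption M εstar εbar Nmin)
    {N a ω δ ρ κ ρx₀ ρε₀ νpos : ℝ} (hN : Nmin ≤ N) (ha : 0 < a) (hω : 0 < ω)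
    (hδ : 0 < δ) (hκ : 0 < κ) (hκ' : κ ≤ εbar - κ) (hρ : ρx₀ ≤ ρ) (hρε₀ : 0 < ρε₀)
    {ξ₀ : EuclideanSpace ℝ (Fin nr)} (hξ₀ : ξ₀ ∈ S.Dr)
    {x₀ : ℝ → State no nc nzo nzc} {e₀ : ℝ → ℝ}
    (hini : S.IsInitialHistory (εstar ξ₀ N) εbar ω ρx₀ ρε₀ νpos x₀ e₀) :
    ∃ x e, S.IsSolutionWhile M εstar a ω δ N ξ₀
        {z | ‖z.1‖ ≤ ρ ∧ z.2 ∈ Icc κ (εbar - κ)} x e ∧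
      EqOn x x₀ (Icc (-S.τd ω) 0) ∧ EqOn e e₀ (Icc (-S.τd ω) 0) := by
  obtain ⟨R, hR⟩ := href.bounded
  obtain ⟨P, K', hPl, hPb, hPid⟩ := exists_retraction
    (ι := Fin no ⊕ Fin nc ⊕ Fin nzo ⊕ Fin nzc) ρ
  obtain ⟨kε, hkε, hεslow⟩ := hslow.εstar_slow
  have hεbar : 0 < εbar := by linarith
  set Kε : ℝ := ρε₀ + εbar + a with hKε
  have hKε0 : 0 < Kε := by positivity
  obtain ⟨C, hC, hJ⟩ := exists_outputBound href hreg hss (max K' Kε)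
  have hJ := hJ N hN ξ₀ hξ₀
  set εs : ℝ → ℝ := εstar ξ₀ N with hεs
  have hεsC := hslow.εstar_smooth N hN ξ₀ hξ₀
  have hεsc : Continuous εs := hεsC.continuous
  -- Lipschitz constants and bounds for the finite-dimensional parts of the vector field
  have hcomp : IsCompact (Metric.closedBall (0 : State no nc nzo nzc) K' ×ˢ
      Metric.closedBall (0 : EuclideanSpace ℝ (Fin nr)) R ×ˢ Icc κ (εbar - κ)) :=
    (isCompact_closedBall _ _).prod ((isCompact_closedBall _ _).prod isCompact_Icc)
  have hcontG := (contDiffOn_ftilde hreg hss hN).mono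
    (show Metric.closedBall (0 : State no nc nzo nzc) K' ×ˢ
      Metric.closedBall (0 : EuclideanSpace ℝ (Fin nr)) R ×ˢ Icc κ (εbar - κ) ⊆
      univ ×ˢ univ ×ˢ Ioc 0 εbar from fun z hz => ⟨trivial, trivial,
        lt_of_lt_of_le hκ hz.2.2.1, by linarith [hz.2.2.2]⟩)
  obtain ⟨LG, hLG⟩ := hcontG.exists_lipschitzOnWith (by norm_num)
    ((convex_closedBall _ _).prod ((convex_closedBall _ _).prod (convex_Icc _ _))) hcomp
  obtain ⟨BG, hBG⟩ := hcomp.exists_bound_of_continuousOn hcontG.continuousOn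
  have hcomp' : IsCompact (Metric.closedBall (0 : EuclideanSpace ℝ (Fin nr)) R ×ˢ
      Icc κ (εbar - κ)) := (isCompact_closedBall _ _).prod isCompact_Icc
  obtain ⟨LH, hLH⟩ := (contDiff_deriv_M hss hN).contDiffOn.exists_lipschitzOnWith (by norm_num)
    ((convex_closedBall _ _).prod (convex_Icc _ _)) hcomp'
  obtain ⟨BH, hBH⟩ := hcomp'.exists_bound_of_continuousOn
    (contDiff_deriv_M hss hN).continuous.continuousOn
  -- the truncated closed loop
  let px : (ℝ → State no nc nzo nzc × ℝ) → ℝ → State no nc nzo nzc := fun y s => P (y s).1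
  let ep : (ℝ → State no nc nzo nzc × ℝ) → ℝ → ℝ := fun y => scanRate εs a ω fun s => (y s).2
  let pe : (ℝ → State no nc nzo nzc × ℝ) → ℝ → ℝ := fun y s => max (-Kε) (min Kε (ep y s))
  let pk : (ℝ → State no nc nzo nzc × ℝ) → ℝ → ℝ := fun y s => max κ (min (εbar - κ) (ep y s))
  let A : (ℝ → State no nc nzo nzc × ℝ) → ℝ → ℝ := fun y =>
    S.adaptRate M a ω δ N ξ₀ (px y) (pe y)
  let H : (ℝ → State no nc nzo nzc × ℝ) → ℝ → State no nc nzo nzc := fun y σ =>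
    deriv (fun η => M (S.ξr N ξ₀ σ) η N) (pk y σ)
  let G : (ℝ → State no nc nzo nzc × ℝ) → ℝ → State no nc nzo nzc := fun y σ =>
    S.ftilde M (px y σ) (S.ξr N ξ₀ σ) (pk y σ) N
  let F : (ℝ → State no nc nzo nzc × ℝ) → ℝ → State no nc nzo nzc × ℝ := fun y σ =>
    (G y σ - (A y σ + a * ω * Real.cos (ω * σ)) • H y σ, A y σ - deriv εs σ)
  have hpx : ∀ y, Continuous y → Continuous (px y) := fun y hy =>
    hPl.continuous.comp (continuous_fst.comp hy)
  have hep : ∀ y, Continuous y → Continuous (ep y) := fun y hy => by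
    change Continuous fun s => (y s).2 + εs s + a * Real.sin (ω * s)
    fun_prop
  have hpe : ∀ y, Continuous y → Continuous (pe y) := fun y hy =>
    continuous_const.max (continuous_const.min (hep y hy))
  have hpk : ∀ y, Continuous y → Continuous (pk y) := fun y hy =>
    continuous_const.max (continuous_const.min (hep y hy))
  have hpem : ∀ y s, ‖px y s‖ ≤ max K' Kε ∧ |pe y s| ≤ max K' Kε := fun y s =>
    ⟨(hPb _).trans (le_max_left _ _), le_trans (abs_le.2 ⟨le_max_left _ _,
      max_le (by linarith) (min_le_left _ _)⟩) (le_max_right _ _)⟩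
  have hpkm : ∀ y s, pk y s ∈ Icc κ (εbar - κ) := fun y s =>
    ⟨le_max_left _ _, max_le hκ' (min_le_left _ _)⟩
  have hξm : ∀ σ, S.ξr N ξ₀ σ ∈ Metric.closedBall (0 : EuclideanSpace ℝ (Fin nr)) R := fun σ =>
    mem_closedBall_zero_iff.2 (hR N hN ξ₀ hξ₀ σ)
  have hpxm : ∀ y s, px y s ∈ Metric.closedBall (0 : State no nc nzo nzc) K' := fun y s =>
    mem_closedBall_zero_iff.2 (hPb _)
  have hA : ∀ y, Continuous y → ∀ σ, |A y σ| ≤ 2 * a * ω * δ * C := fun y hy σ =>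
    abs_adaptRate_le ha hω hδ fun s _ => (hJ s (px y) (pe y) (hpx y hy).continuousOn
      (hpe y hy).continuousOn fun s _ => hpem y s).1
  have hA' : ∀ y, Continuous y → ∀ σ,
      |A y σ + a * ω * Real.cos (ω * σ)| ≤ 2 * a * ω * δ * C + a * ω := fun y hy σ => by
    refine (abs_add_le _ _).trans (add_le_add (hA y hy σ) ?_)
    rw [abs_mul, abs_of_pos (by positivity)]
    exact mul_le_of_le_one_right (by positivity) (Real.abs_cos_le_one _)
  have hGb : ∀ y σ, ‖G y σ‖ ≤ BG := fun y σ =>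
    hBG (px y σ, S.ξr N ξ₀ σ, pk y σ) ⟨hpxm y σ, hξm σ, hpkm y σ⟩
  have hHb : ∀ y σ, ‖H y σ‖ ≤ BH := fun y σ =>
    hBH (S.ξr N ξ₀ σ, pk y σ) ⟨hξm σ, hpkm y σ⟩
  have hdε : ∀ σ, |deriv εs σ| ≤ kε / N := hεslow N hN ξ₀ hξ₀
  have hA0 : 0 ≤ 2 * a * ω * δ * C + a * ω := by positivity
  have hBH0 : 0 ≤ BH := (norm_nonneg _).trans (hHb (fun _ => 0) 0)
  obtain ⟨y, hyc, hy0, hyd⟩ := exists_solution_of_lipschitz F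
    (C := max (BG + (2 * a * ω * δ * C + a * ω) * BH) (2 * a * ω * δ * C + kε / N))
    (L := LG + (2 * a * ω * δ * C * BH + (2 * a * ω * δ * C + a * ω) * LH) + 2 * a * ω * δ * C)
    (by positivity)
    (fun y hy => by
      have h1 := (continuous_adaptRate hreg hss hN ξ₀ (a := a) (ω := ω) (δ := δ)
        (hpx y hy) (hpe y hy)).2
      have h2 : Continuous (H y) :=
        (contDiff_deriv_M hss hN).continuous.comp ((continuous_ξr N ξ₀).prodMk (hpk y hy))
      have h3 : Continuous (G y) := hcontG.continuousOn.comp_continuous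
        ((hpx y hy).prodMk ((continuous_ξr N ξ₀).prodMk (hpk y hy)))
        fun σ => ⟨hpxm y σ, hξm σ, hpkm y σ⟩
      have h4 : Continuous (deriv εs) := hεsC.continuous_deriv (by norm_num)
      have h5 : Continuous fun σ => A y σ + a * ω * Real.cos (ω * σ) :=
        h1.add (by fun_prop)
      exact ((h3.sub (h5.smul h2)).prodMk (h1.sub h4)).continuousOn)
    (fun y hy σ _ => by
      refine norm_prod_le_iff.2 ⟨le_trans ?_ (le_max_left _ _), le_trans ?_ (le_max_right _ _)⟩
      · refine (norm_sub_le _ _).trans (add_le_add (hGb y σ) ?_)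
        rw [norm_smul]
        exact mul_le_mul (hA' y hy σ) (hHb y σ) (norm_nonneg _) hA0
      · exact (abs_sub _ _).trans (add_le_add (hA y hy σ) (hdε σ)))
    (fun y z hy hz σ _ D hD => by
      have hD0 : 0 ≤ D := (norm_nonneg _).trans (hD σ le_rfl)
      have dx : ∀ s ≤ σ, ‖px y s - px z s‖ ≤ D := fun s hs => by
        have h := hPl.dist_le_mul (y s).1 (z s).1
        rw [NNReal.coe_one, one_mul, dist_eq_norm, dist_eq_norm] at h
        exact h.trans ((norm_fst_le (y s - z s)).trans (hD s hs))
      have de : ∀ s ≤ σ, |ep y s - ep z s| ≤ D := fun s hs => by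
        have h : ep y s - ep z s = (y s - z s).2 := by
          simp only [ep, scanRate, Prod.snd_sub]; ring
        rw [h]
        exact (norm_snd_le (y s - z s)).trans (hD s hs)
      have dpe : ∀ s ≤ σ, |pe y s - pe z s| ≤ D := fun s hs =>
        (abs_clamp_sub_le _ _ _ _).trans (de s hs)
      have dpk : |pk y σ - pk z σ| ≤ D := (abs_clamp_sub_le _ _ _ _).trans (de σ le_rfl)
      have dA : |A y σ - A z σ| ≤ 2 * a * ω * δ * C * D := by
        have h := abs_adaptRate_sub_le (S := S) (M := M) (N := N) (ξ₀ := ξ₀) (τ := σ)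
          (C := C * D) ha hω hδ
          (continuous_adaptRate hreg hss hN ξ₀ (a := a) (ω := ω) (δ := δ)
            (hpx y hy) (hpe y hy)).1.continuousOn
          (continuous_adaptRate hreg hss hN ξ₀ (a := a) (ω := ω) (δ := δ)
            (hpx z hz) (hpe z hz)).1.continuousOn
          fun u hu => (hJ u (px y) (pe y) (hpx y hy).continuousOn (hpe y hy).continuousOn
            fun s _ => hpem y s).2 (px z) (pe z) (hpx z hz).continuousOn (hpe z hz).continuousOn
            (fun s _ => hpem z s) D fun s hs =>
              ⟨dx s (hs.2.trans hu.2), dpe s (hs.2.trans hu.2)⟩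
        rwa [← mul_assoc] at h
      have dG : ‖G y σ - G z σ‖ ≤ LG * D := by
        have h := hLG.dist_le_mul (px y σ, S.ξr N ξ₀ σ, pk y σ) ⟨hpxm y σ, hξm σ, hpkm y σ⟩
          (px z σ, S.ξr N ξ₀ σ, pk z σ) ⟨hpxm z σ, hξm σ, hpkm z σ⟩
        rw [dist_eq_norm, Prod.dist_eq, Prod.dist_eq, dist_self] at h
        refine h.trans (mul_le_mul_of_nonneg_left ?_ LG.2)
        refine max_le ?_ (max_le hD0 dpk)
        rw [dist_eq_norm]
        exact dx σ le_rfl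
      have dH : ‖H y σ - H z σ‖ ≤ LH * D := by
        have h := hLH.dist_le_mul (S.ξr N ξ₀ σ, pk y σ) ⟨hξm σ, hpkm y σ⟩
          (S.ξr N ξ₀ σ, pk z σ) ⟨hξm σ, hpkm z σ⟩
        rw [dist_eq_norm, Prod.dist_eq, dist_self] at h
        exact h.trans (mul_le_mul_of_nonneg_left (max_le hD0 dpk) LH.2)
      have dAH := norm_smul_sub_smul_le (α := A y σ + a * ω * Real.cos (ω * σ))
        (β := A z σ + a * ω * Real.cos (ω * σ)) (D₁ := 2 * a * ω * δ * C * D)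
        (by rw [add_sub_add_right_eq_sub]; exact dA)
        (hA' z hz σ) (hHb y σ) dH
      have hx1 : 0 ≤ (LG : ℝ) * D := mul_nonneg LG.2 hD0
      have hx2 : 0 ≤ 2 * a * ω * δ * C * D := by positivity
      have hx3 : 0 ≤ 2 * a * ω * δ * C * D * BH + (2 * a * ω * δ * C + a * ω) * (LH * D) :=
        (norm_nonneg _).trans dAH
      refine norm_prod_le_iff.2 ⟨?_, ?_⟩
      · change ‖(G y σ - (A y σ + a * ω * Real.cos (ω * σ)) • H y σ) -
          (G z σ - (A z σ + a * ω * Real.cos (ω * σ)) • H z σ)‖ ≤ _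
        rw [sub_sub_sub_comm]
        refine (norm_sub_le _ _).trans ((add_le_add dG dAH).trans ?_)
        linarith
      · change |(A y σ - deriv εs σ) - (A z σ - deriv εs σ)| ≤ _
        rw [sub_sub_sub_cancel_right]
        refine dA.trans ?_
        linarith)
    (fun s => (x₀ (max (-S.τd ω) (min 0 s)), e₀ (max (-S.τd ω) (min 0 s))))
    (by
      have hτd : 0 < S.τd ω := by
        have := S.Tl_pos
        unfold τd
        have := Real.pi_pos
        positivity
      have hm : ∀ s, max (-S.τd ω) (min 0 s) ∈ Icc (-S.τd ω) 0 := fun s =>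
        ⟨le_max_left _ _, max_le (by linarith) (min_le_left _ _)⟩
      exact (hini.continuousOn_x.comp_continuous (by fun_prop) hm).prodMk
        (hini.continuousOn_e.comp_continuous (by fun_prop) hm))
  have hy0' : ∀ s ∈ Icc (-S.τd ω) 0, y s = (x₀ s, e₀ s) := fun s hs => by
    rw [hy0 s hs.2, min_eq_right hs.2, max_eq_right hs.1]
  -- the truncation is inactive as long as the region is not left
  have hF : ∀ τ, 0 ≤ τ → (∀ s ∈ Icc 0 τ, ((y s).1, ep y s) ∈
      {z : State no nc nzo nzc × ℝ | ‖z.1‖ ≤ ρ ∧ z.2 ∈ Icc κ (εbar - κ)}) →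
      px y τ = (y τ).1 ∧ pk y τ = ep y τ ∧
      A y τ = S.adaptRate M a ω δ N ξ₀ (fun s => (y s).1) (ep y) τ := fun τ hτ hin => by
    have hτm := hin τ ⟨hτ, le_rfl⟩
    refine ⟨hPid _ hτm.1, ?_, ?_⟩
    · simp only [pk]
      rw [min_eq_right hτm.2.2, max_eq_right hτm.2.1]
    · have hb : ∀ s ∈ Icc (τ - S.τd ω) τ, ‖(y s).1‖ ≤ ρ ∧ |ep y s| ≤ Kε := fun s hs => by
        rcases le_total s 0 with hs0 | hs0
        · have hsm : s ∈ Icc (-S.τd ω) 0 := ⟨by linarith [hs.1], hs0⟩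
          have h1 := hini.norm_x_le s hsm
          have h2 := hini.abs_e_le s hsm
          have h3 := (hmax.maximum N hN ξ₀ hξ₀ s).1
          have h4 : |εs s| ≤ εbar := abs_le.2 ⟨by linarith [h3.1], h3.2⟩
          have h5 : |a * Real.sin (ω * s)| ≤ a := by
            rw [abs_mul, abs_of_pos ha]
            exact mul_le_of_le_one_right ha.le (Real.abs_sin_le_one _)
          have h6 : ep y s = e₀ s + εs s + a * Real.sin (ω * s) := by
            simp only [ep, scanRate, hy0' s hsm]
          rw [h6, hy0' s hsm]
          refine ⟨h1.trans hρ, (abs_add_le _ _).trans (add_le_add ((abs_add_le _ _).trans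
            (add_le_add h2 h4)) h5)⟩
        · have h1 := hin s ⟨hs0, hs.2⟩
          exact ⟨h1.1, abs_le.2 ⟨by linarith [h1.2.1], by linarith [h1.2.2]⟩⟩
      refine adaptRate_congr hω (fun s hs => hPid _ (hb s hs).1) fun s hs => ?_
      have := abs_le.1 (hb s hs).2
      simp only [pe]
      rw [min_eq_right this.2, max_eq_right this.1]
  refine ⟨fun s => (y s).1, fun s => (y s).2, ⟨(continuous_fst.comp hyc).continuousOn,
    (continuous_snd.comp hyc).continuousOn, fun τ hτ hin => ?_, fun τ hτ hin => ?_⟩,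
    fun s hs => by simp only [hy0' s hs], fun s hs => by simp only [hy0' s hs]⟩
  · obtain ⟨h1, h2, h3⟩ := hF τ hτ hin
    have h := (hyd τ hτ).fst
    simp only [F, G, H, h1, h2, h3] at h
    exact h
  · obtain ⟨h1, h2, h3⟩ := hF τ hτ hin
    have h := (hyd τ hτ).snd
    simp only [F, h3] at h
    exact h

end System

/-! ### The original time scale -/

lemma exists_isClock {eps : ℝ → ℝ} {κ B : ℝ} (hc : ContinuousOn eps (Ici 0)) (hκ : 0 < κ)
    (h : ∀ τ, 0 ≤ τ → eps τ ∈ Icc κ B) : ∃ θ, IsClock eps θ := by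
  set g : ℝ → ℝ := fun τ => eps (max τ 0) with hg
  have hgc : Continuous g :=
    hc.comp_continuous (by fun_prop) fun τ => mem_Ici.2 (le_max_right _ _)
  have hgm : ∀ τ, g τ ∈ Icc κ B := fun τ => h _ (le_max_right _ _)
  have hg0 : ∀ τ, 0 < g τ := fun τ => hκ.trans_le (hgm τ).1
  have hB : 0 < B := (hg0 0).trans_le (hgm 0).2
  -- the original time as a function of `τ`; the clock is its inverse
  set Φ : ℝ → ℝ := fun τ => ∫ s in (0 : ℝ)..τ, (g s)⁻¹ with hΦ
  have hΦd : ∀ τ, HasDerivAt Φ (g τ)⁻¹ τ := fun τ =>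
    ((hgc.inv₀ fun s => (hg0 s).ne').integral_hasStrictDerivAt 0 τ).hasDerivAt
  have hΦ0 : Φ 0 = 0 := intervalIntegral.integral_same
  have hΦm : StrictMono Φ := strictMono_of_deriv_pos fun τ => by
    rw [(hΦd τ).deriv]; exact inv_pos.2 (hg0 τ)
  have hmono : Monotone fun τ => Φ τ - B⁻¹ * τ := by
    have hd : ∀ τ, HasDerivAt (fun τ => Φ τ - B⁻¹ * τ) ((g τ)⁻¹ - B⁻¹ * 1) τ := fun τ =>
      (hΦd τ).sub ((hasDerivAt_id τ).const_mul _)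
    refine monotone_of_deriv_nonneg (fun τ => (hd τ).differentiableAt) fun τ => ?_
    rw [(hd τ).deriv, mul_one, sub_nonneg]
    exact inv_anti₀ (hg0 τ) (hgm τ).2
  have htop : Tendsto Φ atTop atTop := by
    refine tendsto_atTop_mono' _ ?_ (tendsto_id.const_mul_atTop (inv_pos.2 hB))
    filter_upwards [eventually_ge_atTop 0] with τ hτ
    have := hmono hτ
    simp only [hΦ0, mul_zero, sub_zero, id] at this ⊢
    linarith
  have hbot : Tendsto Φ atBot atBot := by
    refine tendsto_atBot_mono' _ ?_ (tendsto_id.const_mul_atBot (inv_pos.2 hB))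
    filter_upwards [eventually_le_atBot 0] with τ hτ
    have := hmono hτ
    simp only [hΦ0, mul_zero, sub_zero, id] at this ⊢
    linarith
  have hΦc : Continuous Φ := continuous_iff_continuousAt.2 fun τ => (hΦd τ).continuousAt
  set Ψ : ℝ ≃o ℝ := hΦm.orderIsoOfSurjective Φ (hΦc.surjective htop hbot) with hΨ
  have hΨ0 : Ψ.symm 0 = 0 := by
    rw [OrderIso.symm_apply_eq]; exact hΦ0.symm
  refine ⟨Ψ.symm, hΨ0, fun t ht => ?_⟩
  have h1 : HasDerivAt Ψ.symm ((g (Ψ.symm t))⁻¹)⁻¹ t :=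
    HasDerivAt.of_local_left_inverse Ψ.symm.continuous.continuousAt (hΦd (Ψ.symm t))
      (inv_ne_zero (hg0 _).ne') (Eventually.of_forall fun y => Ψ.apply_symm_apply y)
  have h2 : 0 ≤ Ψ.symm t := by
    rw [← hΨ0]; exact Ψ.symm.monotone ht
  rw [inv_inv] at h1
  simp only [hg, max_eq_left h2] at h1
  exact h1.hasDerivWithinAt

lemma IsClock.nonneg {eps θ : ℝ → ℝ} (hθ : IsClock eps θ) (h0 : 0 < eps 0) {t : ℝ}
    (ht : 0 ≤ t) : 0 ≤ θ t := by
  have := image_le_of_deriv_right_lt_deriv_boundary' (f := fun t => -θ t)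
    (f' := fun t => -eps (θ t)) (a := 0) (b := t) (B := fun _ => 0) (B' := fun _ => 0)
    (fun s hs => ((hθ.hasDeriv s hs.1).continuousWithinAt.mono Icc_subset_Ici_self).neg)
    (fun s hs => ((hθ.hasDeriv s hs.1).mono (Ici_subset_Ici.2 hs.1)).neg)
    (by simp [hθ.map_zero]) continuousOn_const (fun s _ => hasDerivWithinAt_const _ _ _)
    (fun s _ hs0 => by
      rw [neg_eq_zero] at hs0
      rw [hs0]; linarith) (right_mem_Icc.2 ht)
  linarith

lemma IsClock.mul_sub_le {eps θ : ℝ → ℝ} (hθ : IsClock eps θ) {κ : ℝ} (hκ : 0 < κ)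
    (h : ∀ τ, 0 ≤ τ → κ ≤ eps τ) {s t : ℝ} (hs : 0 ≤ s) (hst : s ≤ t) :
    κ * (t - s) ≤ θ t - θ s := by
  have h0 : 0 < eps 0 := hκ.trans_le (h 0 le_rfl)
  have := image_le_of_deriv_right_le_deriv_boundary (f := fun t => -θ t)
    (f' := fun t => -eps (θ t)) (a := s) (b := t) (B := fun t => -θ s - κ * (t - s))
    (B' := fun _ => -κ)
    (fun u hu => ((hθ.hasDeriv u (hs.trans hu.1)).continuousWithinAt.mono
      (Icc_subset_Ici_self.trans (Ici_subset_Ici.2 hs))).neg)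
    (fun u hu => ((hθ.hasDeriv u (hs.trans hu.1)).mono
      (Ici_subset_Ici.2 (hs.trans hu.1))).neg)
    (by simp) (by fun_prop) (fun u _ => by
      have := (((hasDerivAt_id u).sub_const s).const_mul κ).const_sub (-θ s)
      simpa using this.hasDerivWithinAt)
    (fun u hu => neg_le_neg (h _ (hθ.nonneg h0 (hs.trans hu.1)))) (right_mem_Icc.2 hst)
  linarith

lemma limsup_le_of_eventually_le {f : ℝ → ℝ} {ν : ℝ} (h0 : ∀ t, 0 ≤ f t)
    (h : ∀ᶠ t in atTop, f t ≤ ν) : limsup f atTop ≤ ν :=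
  limsup_le_of_le (isBoundedUnder_of ⟨0, h0⟩ : IsBoundedUnder (· ≥ ·) atTop f).isCoboundedUnder_le h

lemma System.IsSolution.isSolutionWhile {nr no nc nzo nzc : ℕ} {S : System nr no nc nzo nzc}
    {M : EuclideanSpace ℝ (Fin nr) → ℝ → ℝ → State no nc nzo nzc}
    {εstar : EuclideanSpace ℝ (Fin nr) → ℝ → ℝ → ℝ} {a ω δ N : ℝ}
    {ξ₀ : EuclideanSpace ℝ (Fin nr)} {x : ℝ → State no nc nzo nzc} {e : ℝ → ℝ}
    (h : S.IsSolution M εstar a ω δ N ξ₀ x e) (P : Set (State no nc nzo nzc × ℝ)) :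
    S.IsSolutionWhile M εstar a ω δ N ξ₀ P x e :=
  ⟨h.continuousOn_x, h.continuousOn_e, fun τ hτ _ => h.hasDeriv_x τ hτ,
    fun τ hτ _ => h.hasDeriv_e τ hτ⟩

end AFM

theorem corollary1 {nr no nc nzo nzc : ℕ} (S : AFM.System nr no nc nzo nzc)
    (M : EuclideanSpace ℝ (Fin nr) → ℝ → ℝ → AFM.State no nc nzo nzc)
    (εstar : EuclideanSpace ℝ (Fin nr) → ℝ → ℝ → ℝ)
    (εbar Nmin : ℝ) (hεbar : 0 < εbar) (hNmin : 0 < Nmin)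
    (href : S.ReferenceAssumption Nmin)
    (hreg : S.RegularityAssumption εbar Nmin)
    (hss : S.SteadyStateAssumption M εbar Nmin)
    (hmax : S.MaximumAssumption M εstar εbar Nmin)
    (hslow : S.SlowlyVaryingAssumption M εstar εbar Nmin) :
    ∀ ρx₀ ρε₀ : ℝ, 0 < ρx₀ → 0 < ρε₀ → ∀ νpos ∈ Ioo 0 (εbar / 2),
    ∀ νx νε : ℝ, 0 < νx → 0 < νε →
    ∃ ρx ρε : ℝ, 0 < ρx ∧ 0 < ρε ∧
    ∃ aMax : ℝ, 0 < aMax ∧ ∀ a ∈ Ioo 0 aMax,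
    ∃ ωMax : ℝ, 0 < ωMax ∧ ∀ ω ∈ Ioo 0 ωMax,
    ∃ δMax : ℝ, 0 < δMax ∧ ∀ δ ∈ Ioo 0 δMax,
    ∃ NLow : ℝ, 0 < NLow ∧ ∀ N : ℝ, NLow < N → ∀ ξ₀ ∈ S.Dr,
      -- every admissible initial history has a solution
      (∀ x₀ e₀, S.IsInitialHistory (εstar ξ₀ N) εbar ω ρx₀ ρε₀ νpos x₀ e₀ →
        ∃ x e, S.IsSolution M εstar a ω δ N ξ₀ x e ∧
          EqOn x x₀ (Icc (-S.τd ω) 0) ∧ EqOn e e₀ (Icc (-S.τd ω) 0)) ∧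
      -- every solution with an admissible initial history satisfies the bounds
      ∀ x e, S.IsSolution M εstar a ω δ N ξ₀ x e →
        S.IsInitialHistory (εstar ξ₀ N) εbar ω ρx₀ ρε₀ νpos x e →
        -- in the time scale `τ`
        ((∀ τ : ℝ, 0 ≤ τ → ‖x τ‖ ≤ ρx ∧ |e τ| ≤ ρε) ∧
          limsup (fun τ => ‖x τ‖) atTop ≤ νx ∧ limsup (fun τ => |e τ|) atTop ≤ νε ∧
          ∀ τ : ℝ, 0 ≤ τ → AFM.scanRate (εstar ξ₀ N) a ω e τ ∈ Ioo 0 εbar) ∧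
        -- in the original time `t`
        (∃ θ, AFM.IsClock (AFM.scanRate (εstar ξ₀ N) a ω e) θ) ∧
        ∀ θ, AFM.IsClock (AFM.scanRate (εstar ξ₀ N) a ω e) θ →
          StrictMonoOn θ (Ici 0) ∧ Tendsto θ atTop atTop ∧
          (∀ t : ℝ, 0 ≤ t → ‖x (θ t)‖ ≤ ρx ∧ |e (θ t)| ≤ ρε) ∧
          limsup (fun t => ‖x (θ t)‖) atTop ≤ νx ∧
          limsup (fun t => |e (θ t)|) atTop ≤ νε := by
  intro ρx₀ ρε₀ hρx₀ hρε₀ νpos hνpos νx νε hνx hνε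
  obtain ⟨ρ, κ, hρ, hκ, hκ', aMax, haMax, H⟩ := AFM.System.eventually_trapped hεbar hNmin href
    hreg hss hmax hslow hρx₀ hρε₀ hνpos.1 hνx hνε
  refine ⟨ρ, εbar, hρx₀.trans_le hρ, hεbar, aMax, haMax, fun a ha => ?_⟩
  obtain ⟨ωMax, hωMax, H⟩ := H a ha
  refine ⟨ωMax, hωMax, fun ω hω => ?_⟩
  obtain ⟨δMax, hδMax, H⟩ := H ω hω
  refine ⟨δMax, hδMax, fun δ hδ => ?_⟩
  obtain ⟨NLow, hNLow, H⟩ := H δ hδ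
  refine ⟨NLow, hNmin.trans hNLow, fun N hN ξ₀ hξ₀ => ⟨fun x₀ e₀ hini => ?_,
    fun x e hsol hini => ?_⟩⟩
  · obtain ⟨x, e, hsol, hx, he⟩ := AFM.System.exists_isSolutionWhile href hreg hss hmax hslow
      (hNLow.le.trans hN.le) ha.1 hω.1 hδ.1 hκ hκ' hρ hρε₀ hξ₀ hini
    have hτd : (0 : ℝ) ∈ Icc (-S.τd ω) 0 := by
      have h1 := S.Tl_pos
      have h2 := hω.1
      have : 0 < S.τd ω := by unfold AFM.System.τd; positivity
      exact ⟨by linarith, le_rfl⟩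
    have hini' : S.IsInitialHistory (εstar ξ₀ N) εbar ω ρx₀ ρε₀ νpos x e :=
      ⟨hini.continuousOn_x.congr hx, hini.continuousOn_e.congr he,
        fun σ hσ => by rw [hx hσ]; exact hini.norm_x_le σ hσ,
        fun σ hσ => by rw [he hσ]; exact hini.abs_e_le σ hσ,
        by rw [he hτd]; exact hini.start⟩
    have hin := (H N hN ξ₀ hξ₀ x e hsol hini').1
    exact ⟨x, e, ⟨hsol.continuousOn_x, hsol.continuousOn_e,
      fun τ hτ => hsol.hasDeriv_x τ hτ fun s hs => ⟨(hin s hs.1).1, (hin s hs.1).2.2⟩,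
      fun τ hτ => hsol.hasDeriv_e τ hτ fun s hs => ⟨(hin s hs.1).1, (hin s hs.1).2.2⟩⟩, hx, he⟩
  · obtain ⟨hin, hlx, hle⟩ := H N hN ξ₀ hξ₀ x e (hsol.isSolutionWhile _) hini
    have hε0 : ∀ τ, 0 ≤ τ → κ ≤ AFM.scanRate (εstar ξ₀ N) a ω e τ := fun τ hτ =>
      (hin τ hτ).2.2.1
    refine ⟨⟨fun τ hτ => ⟨(hin τ hτ).1, (hin τ hτ).2.1⟩,
      AFM.limsup_le_of_eventually_le (fun τ => norm_nonneg _) hlx,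
      AFM.limsup_le_of_eventually_le (fun τ => abs_nonneg _) hle,
      fun τ hτ => ⟨hκ.trans_le (hε0 τ hτ), (hin τ hτ).2.2.2.trans_lt (by linarith)⟩⟩, ?_,
      fun θ hθ => ?_⟩
    · refine AFM.exists_isClock ?_ hκ fun τ hτ => (hin τ hτ).2.2
      have hsub : Ici (0 : ℝ) ⊆ Ici (-S.τd ω) := Ici_subset_Ici.2 (by
        have h1 := S.Tl_pos
        have h2 := hω.1
        have : 0 < S.τd ω := by unfold AFM.System.τd; positivity
        linarith)
      have hεs := (hslow.εstar_smooth N (hNLow.le.trans hN.le) ξ₀ hξ₀).continuous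
      exact ((hsol.continuousOn_e.mono hsub).add hεs.continuousOn).add (by fun_prop)
    · have hθ0 : ∀ t, 0 ≤ t → 0 ≤ θ t := fun t ht =>
        hθ.nonneg (hκ.trans_le (hε0 0 le_rfl)) ht
      have htop : Tendsto θ atTop atTop := by
        refine tendsto_atTop_mono' _ ?_ (tendsto_id.const_mul_atTop hκ)
        filter_upwards [eventually_ge_atTop 0] with t ht
        have := hθ.mul_sub_le hκ hε0 le_rfl ht
        rwa [hθ.map_zero, sub_zero, sub_zero] at this
      refine ⟨fun s hs t _ hst => ?_, htop,
        fun t ht => ⟨(hin _ (hθ0 t ht)).1, (hin _ (hθ0 t ht)).2.1⟩,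
        AFM.limsup_le_of_eventually_le (fun t => norm_nonneg _) (htop.eventually hlx),
        AFM.limsup_le_of_eventually_le (fun t => abs_nonneg _) (htop.eventually hle)⟩
      have h1 := hθ.mul_sub_le hκ hε0 hs hst.le
      have h2 : 0 < κ * (t - s) := mul_pos hκ (sub_pos.2 hst)
      linarith
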